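/- Let $M$ be a closed (compact, connected) surface with a Euclidean polyhedral metric, i.e. every point $x \in M$ has a neighbourhood isometric either to an open subset of $\mathbb{R}^2$ ($x$ is then regular), or to an open subset of a Euclidean cone of some angle $\alpha \neq 2\pi$ with $x$ mapped to the apex ($x$ is then singular). Assume that the set $\Sigma$ of singular points is non-empty. (The principal case is that of $M$ homeomorphic to the sphere.) A geodesic triangulation $T$ of $M$ is a decomposition of $M$ into finitely many Euclidean triangles by geodesics, with vertex set exactly $\Sigma$; multiple edges, loops and self-identifications on the boundary of triangles are allowed. Consider couples $(T,r)$, where $T$ is a geodesic triangulation of $M$ and $r = (r_i)_{i\in\Sigma}$ are positive numbers (radii) such that for every triangle $ijk$ of $T$ there is a non-degenerate pyramid in $\mathbb{R}^3$ with base $ijk$ and side edges of lengths $r_i, r_j, r_k$. Gluing these pyramids according to $T$ gives a polyhedral complex with boundary $M$, equipped with its intrinsic metric; all apices are glued to one point, the apex. Two couples are equivalent if there is an isometry between the resulting complexes which is the identity on the boundary $M$ and maps the apex to the apex. A generalized polytope with boundary $M$ is an equivalence class of couples. It is a generalized convex polytope if, for some representative $(T,r)$ and every edge $e$ of $T$,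 the sum $\theta_e$ of the dihedral angles of the pyramids at $e$ is at most $\pi$. **Proposition.** Let $P$ and $P'$ be generalized convex polytopes with boundary $M$, represented by couples $(T,r)$ and $(T',r')$ respectively. If $r = r'$, then $P = P'$. -/

import Mathlib

open Set Metric

/-- The Euclidean plane. -/
abbrev E2 : Type := EuclideanSpace ℝ (Fin 2)

/-- Euclidean three-space. -/
abbrev E3 : Type := EuclideanSpace ℝ (Fin 3)

/-- The standard isometric embedding of the plane as the horizontal plane of height zero. -/
noncomputable def planeIncl (x : E2) : E3 := !₂[x 0, x 1, 0]

section PolyhedralMetric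

/-- The distance, in the Euclidean cone of total angle `α`, between the points with polar coordinates
`(s, a)` and `(t, b)`. The angular coordinate lives on the circle of length `α`, and `‖a - b‖` is the
length of the shorter arc between `a` and `b`. The apex has radial coordinate `0`. -/
noncomputable def coneDist (α : ℝ) (s : ℝ) (a : AddCircle α) (t : ℝ) (b : AddCircle α) : ℝ :=
  Real.sqrt (s ^ 2 + t ^ 2 - 2 * s * t * Real.cos (min ‖a - b‖ Real.pi))

variable {M : Type*} [MetricSpace M]

/-- A small ball around `x` is isometric to a disc of the Euclidean plane. -/
def IsRegularPoint (x : M) : Prop :=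
  ∃ ε : ℝ, 0 < ε ∧ ∃ c : E2 → M, c 0 = x ∧
    (∀ y ∈ ball (0 : E2) ε, ∀ z ∈ ball (0 : E2) ε, dist (c y) (c z) = dist y z) ∧
    c '' ball (0 : E2) ε = ball x ε

/-- A small ball around `x` is isometric to a ball around the apex of a cone of angle `α ≠ 2π`,
with `x` corresponding to the apex (the chart `c` is written in polar coordinates). -/
def IsSingularPoint (x : M) : Prop :=
  ∃ α : ℝ, 0 < α ∧ α ≠ 2 * Real.pi ∧ ∃ ε : ℝ, 0 < ε ∧ ∃ c : ℝ → AddCircle α → M,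
    (∀ a, c 0 a = x) ∧
    (∀ s ∈ Ico (0 : ℝ) ε, ∀ a, ∀ t ∈ Ico (0 : ℝ) ε, ∀ b,
      dist (c s a) (c t b) = coneDist α s a t b) ∧
    (∀ m : M, m ∈ ball x ε ↔ ∃ s ∈ Ico (0 : ℝ) ε, ∃ a, c s a = m)

variable (M)

/-- The metric of `M` is a Euclidean polyhedral metric. -/
def IsEuclideanPolyhedral : Prop := ∀ x : M, IsRegularPoint x ∨ IsSingularPoint x

/-- The set of singular points. -/
def singularSet : Set M := {x | IsSingularPoint x}

end PolyhedralMetric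

/-- The closed planar triangle with vertices `p 0, p 1, p 2`. -/
def solidTriangle (p : Fin 3 → E2) : Set E2 := convexHull ℝ (range p)

/-- The closed side of a triangle opposite to the vertex `k`. -/
def triSide (p : Fin 3 → E2) (k : Fin 3) : Set E2 := segment ℝ (p (k + 1)) (p (k + 2))

/-- The open side of a triangle opposite to the vertex `k`. -/
def triOpenSide (p : Fin 3 → E2) (k : Fin 3) : Set E2 := openSegment ℝ (p (k + 1)) (p (k + 2))

/-- A geodesic triangulation of `M`: a decomposition of `M` into finitely many Euclidean triangles by
geodesics, the set of vertices being the singular set. Multiple edges, loops and self-identifications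
on the boundary of a triangle are allowed, so a face is given by a planar triangle together with its
map to `M`. Only the restriction of that map to the closed triangle matters. -/
structure GeodesicTriangulation (M : Type*) [MetricSpace M] where
  /-- the number of faces -/
  numFaces : ℕ
  /-- the vertices of the planar triangle that is a development of the face -/
  corner : Fin numFaces → Fin 3 → E2
  nondegenerate : ∀ f, AffineIndependent ℝ (corner f)
  /-- the map from the planar triangle to `M` -/
  toM : Fin numFaces → E2 → M
  continuousOn : ∀ f, ContinuousOn (toM f) (solidTriangle (corner f))
  /-- away from the vertices the map is a local isometry; hence sides are geodesics -/
  local_isometry : ∀ f, ∀ x ∈ solidTriangle (corner f), x ∉ range (corner f) →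
    ∃ ε : ℝ, 0 < ε ∧ ∀ y ∈ solidTriangle (corner f) ∩ ball x ε,
      ∀ z ∈ solidTriangle (corner f) ∩ ball x ε, dist (toM f y) (toM f z) = dist y z
  covers : ∀ m : M, ∃ f, ∃ x ∈ solidTriangle (corner f), toM f x = m
  /-- the vertices of the triangulation are exactly the singular points -/
  vertex_iff : ∀ f, ∀ x ∈ solidTriangle (corner f),
    toM f x ∈ singularSet M ↔ x ∈ range (corner f)
  /-- no identifications at interior points of triangles -/
  interior_unique : ∀ f g, ∀ x ∈ interior (solidTriangle (corner f)),
    ∀ y ∈ solidTriangle (corner g), toM f x = toM g y → f = g ∧ x = y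
  /-- open edges have no self-intersections -/
  side_injOn : ∀ f k, InjOn (toM f) (triOpenSide (corner f) k)
  /-- two open sides that meet represent the same edge -/
  side_match : ∀ f k g l, ∀ x ∈ triOpenSide (corner f) k, ∀ y ∈ triOpenSide (corner g) l,
    toM f x = toM g y → toM f '' triSide (corner f) k = toM g '' triSide (corner g) l

namespace GeodesicTriangulation

variable {M : Type*} [MetricSpace M] (T : GeodesicTriangulation M)

/-- The closed planar triangle of the face `f`. -/
def tri (f : Fin T.numFaces) : Set E2 := solidTriangle (T.corner f)

theorem corner_mem_tri (f : Fin T.numFaces) (k : Fin 3) : T.corner f k ∈ T.tri f :=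
  subset_convexHull ℝ _ (mem_range_self k)

/-- The vertex (a singular point of `M`) at the corner `k` of the face `f`. -/
def vertex (f : Fin T.numFaces) (k : Fin 3) : singularSet M :=
  ⟨T.toM f (T.corner f k), (T.vertex_iff f _ (T.corner_mem_tri f k)).2 (mem_range_self k)⟩

/-- The edge of the triangulation, as a subset of `M`, that carries the side `k` of the face `f`. -/
def edge (f : Fin T.numFaces) (k : Fin 3) : Set M := T.toM f '' triSide (T.corner f) k

end GeodesicTriangulation

/-- A couple `(T, r)`: a geodesic triangulation and positive radii at the singular points, such that
over every triangle there is a (non-degenerate) pyramid whose side edges have the prescribed lengths.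
The base of the pyramid is placed in the horizontal plane, the apex in the upper half-space. -/
structure Couple (M : Type*) [MetricSpace M] where
  T : GeodesicTriangulation M
  r : singularSet M → ℝ
  r_pos : ∀ i, 0 < r i
  exists_pyramid : ∀ f, ∃ a : E3, 0 < a 2 ∧
    ∀ k, dist a (planeIncl (T.corner f k)) = r (T.vertex f k)

/-- The dihedral angle at the line through `p` and `q` of the wedge bounded by the two half-planes
that start at this line and contain `u` and `v` respectively. -/
noncomputable def dihedralAngle (p q u v : E3) : ℝ :=
  InnerProductGeometry.angle
    ((u - p) - (inner ℝ (q - p) (u - p) / ‖q - p‖ ^ 2) • (q - p))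
    ((v - p) - (inner ℝ (q - p) (v - p) / ‖q - p‖ ^ 2) • (q - p))

namespace Couple

variable {M : Type*} [MetricSpace M] (C : Couple M)

/-- The apex of the pyramid over the face `f`; it is unique, since its height is positive. -/
noncomputable def apex (f : Fin C.T.numFaces) : E3 := (C.exists_pyramid f).choose

/-- The solid pyramid over the face `f`. -/
def pyramid (f : Fin C.T.numFaces) : Set E3 :=
  convexHull ℝ (insert (C.apex f) (range fun k => planeIncl (C.T.corner f k)))

/-- The disjoint union of all pyramids. -/
def Pieces : Type := Σ f : Fin C.T.numFaces, C.pyramid f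

/-- The gluing rule. The point dividing the segment from the apex to a base point `x` in the ratio
given by `t` is glued to the point with the same `t` over a base point `x'` that represents the same
point of `M`; for `t = 0`, all apices are glued together. -/
def Glued (y z : C.Pieces) : Prop :=
  ∃ t ∈ Icc (0 : ℝ) 1, ∃ x ∈ C.T.tri y.1, ∃ x' ∈ C.T.tri z.1,
    (y.2 : E3) = AffineMap.lineMap (C.apex y.1) (planeIncl x) t ∧
    (z.2 : E3) = AffineMap.lineMap (C.apex z.1) (planeIncl x') t ∧
    (t = 0 ∨ C.T.toM y.1 x = C.T.toM z.1 x')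

/-- The set of points of the polyhedral complex glued from the pyramids. -/
def Polyhedron : Type := Quot C.Glued

/-- The point of the complex represented by a point of the pyramid over `f`. -/
def pointOf (f : Fin C.T.numFaces) (y : C.pyramid f) : C.Polyhedron := Quot.mk C.Glued ⟨f, y⟩

/-- `C.Chain P Q ℓ`: there is a broken line of length `ℓ` from `P` to `Q` in the complex, consisting
of finitely many straight segments each of which lies in one pyramid. -/
inductive Chain : C.Polyhedron → C.Polyhedron → ℝ → Prop
  | nil (P : C.Polyhedron) : Chain P P 0
  | cons (f : Fin C.T.numFaces) (y z : C.pyramid f) (Q : C.Polyhedron) (ℓ : ℝ)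
      (h : Chain (C.pointOf f z) Q ℓ) : Chain (C.pointOf f y) Q (dist y z + ℓ)

/-- The intrinsic distance of the glued complex: the infimum of lengths of broken lines. -/
noncomputable def polyDist (P Q : C.Polyhedron) : ℝ := sInf {ℓ | C.Chain P Q ℓ}

theorem planeIncl_mem {f : Fin C.T.numFaces} {x : E2} (hx : x ∈ C.T.tri f) :
    planeIncl x ∈ C.pyramid f := by
  let L : E2 →ₗ[ℝ] E3 :=
    { toFun := planeIncl
      map_add' := fun x y => by ext i; fin_cases i <;> simp [planeIncl]
      map_smul' := fun c x => by ext i; fin_cases i <;> simp [planeIncl] }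
  have h : L '' C.T.tri f ⊆ C.pyramid f := by
    unfold GeodesicTriangulation.tri solidTriangle
    rw [L.image_convexHull]
    refine convexHull_mono ?_
    rintro _ ⟨_, ⟨k, rfl⟩, rfl⟩
    exact mem_insert_of_mem _ ⟨k, rfl⟩
  exact h ⟨x, hx, rfl⟩

theorem apex_mem (f : Fin C.T.numFaces) : C.apex f ∈ C.pyramid f :=
  subset_convexHull ℝ _ (mem_insert _ _)

/-- The boundary point of the complex represented by the point `x` of the base triangle `f`. Under
the identification of the boundary with `M` it is the point `C.T.toM f x`. -/
noncomputable def boundaryPoint (f : Fin C.T.numFaces) (x : E2) (hx : x ∈ C.T.tri f) :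
    C.Polyhedron :=
  C.pointOf f ⟨planeIncl x, C.planeIncl_mem hx⟩

/-- The apex of the complex (the same point for all `f`). -/
noncomputable def apexPoint (f : Fin C.T.numFaces) : C.Polyhedron :=
  C.pointOf f ⟨C.apex f, C.apex_mem f⟩

/-- The two glued complexes are isometric by an isometry which is the identity on the boundary `M`
and maps the apex to the apex. -/
def Equivalent (C C' : Couple M) : Prop :=
  ∃ Φ : C.Polyhedron ≃ C'.Polyhedron,
    (∀ P Q, C'.polyDist (Φ P) (Φ Q) = C.polyDist P Q) ∧
    (∀ f x hx g y hy, C.T.toM f x = C'.T.toM g y →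
      Φ (C.boundaryPoint f x hx) = C'.boundaryPoint g y hy) ∧
    (∀ f g, Φ (C.apexPoint f) = C'.apexPoint g)

theorem boundaryPoint_eq {f g : Fin C.T.numFaces} {x y : E2} (hx : x ∈ C.T.tri f)
    (hy : y ∈ C.T.tri g) (h : C.T.toM f x = C.T.toM g y) :
    C.boundaryPoint f x hx = C.boundaryPoint g y hy :=
  Quot.sound ⟨1, by simp, x, hx, y, hy, by simp, by simp, Or.inr h⟩

theorem apexPoint_eq (f g : Fin C.T.numFaces) : C.apexPoint f = C.apexPoint g :=
  Quot.sound ⟨0, by simp, _, C.T.corner_mem_tri f 0, _, C.T.corner_mem_tri g 0,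
    by simp, by simp, Or.inl rfl⟩

theorem equivalent_refl (C : Couple M) : Equivalent C C :=
  ⟨Equiv.refl _, fun _ _ => rfl, fun _ _ hx _ _ hy h => C.boundaryPoint_eq hx hy h,
    fun f g => C.apexPoint_eq f g⟩

theorem equivalent_symm {C C' : Couple M} : Equivalent C C' → Equivalent C' C := by
  rintro ⟨Φ, h1, h2, h3⟩
  refine ⟨Φ.symm, fun P Q => ?_, fun f x hx g y hy h => ?_, fun f g => ?_⟩
  · rw [← h1, Φ.apply_symm_apply, Φ.apply_symm_apply]
  · rw [Equiv.symm_apply_eq, h2 g y hy f x hx h.symm]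
  · rw [Equiv.symm_apply_eq, h3 g f]

theorem equivalent_trans {C C' C'' : Couple M} :
    Equivalent C C' → Equivalent C' C'' → Equivalent C C'' := by
  rintro ⟨Φ, h1, h2, h3⟩ ⟨Ψ, k1, k2, k3⟩
  refine ⟨Φ.trans Ψ, fun P Q => ?_, fun f x hx g y hy h => ?_, fun f g => ?_⟩
  · rw [Equiv.trans_apply, Equiv.trans_apply, k1, h1]
  · obtain ⟨e, z, hz, hez⟩ := C'.T.covers (C.T.toM f x)
    rw [Equiv.trans_apply, h2 f x hx e z hz hez.symm, k2 e z hz g y hy (hez.trans h)]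
  · obtain ⟨e, -⟩ := C'.T.covers (C.T.toM f 0)
    rw [Equiv.trans_apply, h3 f e, k3 e g]

/-- The dihedral angle at the base side `k` of the pyramid over the face `f`. -/
noncomputable def baseAngle (f : Fin C.T.numFaces) (k : Fin 3) : ℝ :=
  dihedralAngle (planeIncl (C.T.corner f (k + 1))) (planeIncl (C.T.corner f (k + 2)))
    (planeIncl (C.T.corner f k)) (C.apex f)

open Classical in
/-- The dihedral angle `θ` of the complex at the boundary edge that carries the side `k` of the face
`f`: the sum of the dihedral angles of the pyramids at all sides representing this edge (two sides,
possibly of the same face). -/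
noncomputable def theta (f : Fin C.T.numFaces) (k : Fin 3) : ℝ :=
  ∑ s : Fin C.T.numFaces × Fin 3,
    if C.T.edge s.1 s.2 = C.T.edge f k then C.baseAngle s.1 s.2 else 0

/-- All dihedral angles at boundary edges are at most `π`. -/
def IsConvex : Prop := ∀ f k, C.theta f k ≤ Real.pi

end Couple

/-- Equivalence of couples. -/
def coupleSetoid (M : Type*) [MetricSpace M] : Setoid (Couple M) where
  r := Couple.Equivalent
  iseqv := ⟨Couple.equivalent_refl, Couple.equivalent_symm, Couple.equivalent_trans⟩

/-- A generalized polytope with boundary `M`: an equivalence class of couples. -/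
def GeneralizedPolytope (M : Type*) [MetricSpace M] : Type _ := Quotient (coupleSetoid M)

/-- The generalized polytope represented by a couple. -/
def Couple.polytope {M : Type*} [MetricSpace M] (C : Couple M) : GeneralizedPolytope M :=
  Quotient.mk (coupleSetoid M) C

/-- The space of generalized convex polytopes with boundary `M`: the generalized polytopes some
representative of which has all dihedral angles at boundary edges at most `π`. -/
def convexPolytopes (M : Type*) [MetricSpace M] : Set (GeneralizedPolytope M) :=
  {P | ∃ C : Couple M, C.polytope = P ∧ C.IsConvex}

/-! The squared distance to the apex is a function `q` on `M` (`sqDist`), and it carries all the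
information. On each face `q` is the squared norm plus an affine function (`apexSq_eq`). Hence, for
points at distance `ρ` on opposite sides of a centre within one face, the sum of the two values is
exactly twice the central value plus `2ρ²`. At a boundary edge the law of cosines for the dihedral
angles `α`, `β` of two adjacent pyramids changes this sum by a nonpositive multiple of `cos α + cos
β`. The condition `α + β ≤ π` makes that factor nonnegative. So for a convex couple equality weakens
to `≤` at every regular point (`IsConvex.exists_sqDist_add_le`).

Let `C` be convex and let `C'` be any couple with the same radii. On a triangle of `C'`, the
difference `q_C - q_C'` is locally midpoint concave along some direction through every point that is
not a vertex, and it vanishes at the vertices. A minimum principle (`nonneg_of_midpoint_le`) gives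
`q_C ≥ q_C'`. When both couples are convex, exchanging their roles gives `q_C = q_C'`; no common
refinement of the triangulations is needed.

Finally, `q` determines the complex. Each point has cone coordinates `(m, t)` with `m` in `M` and
`t` in the unit interval. Inside a pyramid, distances depend only on `t`, on `q` and on base
distances (`dist_facePoint_sq`). The map preserving cone coordinates therefore takes a straight
segment of one complex to a path that is locally no longer in the other, except possibly at the
ends, which continuity handles. Both intrinsic metrics agree (`polyDist_conePoint_eq`). -/

open Topology Filter

/-! ### Minimum principle, compact fibres and elementary Euclidean facts -/

section Generalities

/-- The part of `K` outside the balls around the fibre over `m` is compact, so its image is closed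
and misses `m`. This replaces local inverses of the face maps: a nearby point of `M` has all its
preimages near preimages of `m`. -/
theorem eventually_forall_preimage_near {X Y : Type*} [PseudoMetricSpace X] [TopologicalSpace Y]
    [T2Space Y] {K : Set X} (hK : IsCompact K) {φ : X → Y} (hφ : ContinuousOn φ K) {ε : X → ℝ}
    (m : Y) (hε : ∀ x ∈ K, φ x = m → 0 < ε x) :
    ∀ᶠ m' in 𝓝 m, ∀ x ∈ K, φ x = m' → ∃ x₀ ∈ K, φ x₀ = m ∧ dist x x₀ < ε x₀ := by
  set U : Set X := ⋃ x₀ ∈ {x | x ∈ K ∧ φ x = m}, ball x₀ (ε x₀) with hU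
  have hUo : IsOpen U := isOpen_biUnion fun _ _ => isOpen_ball
  have hB : IsClosed (φ '' (K \ U)) :=
    ((hK.diff hUo).image_of_continuousOn (hφ.mono sdiff_subset)).isClosed
  have hm : m ∉ φ '' (K \ U) := by
    rintro ⟨x, ⟨hxK, hxU⟩, hx⟩
    exact hxU (mem_biUnion (show x ∈ {x | x ∈ K ∧ φ x = m} from ⟨hxK, hx⟩)
      (mem_ball_self (hε x hxK hx)))
  filter_upwards [hB.isOpen_compl.mem_nhds hm] with m' hm' x hx hxm
  by_contra hcon
  refine hm' ⟨x, ⟨hx, fun hxU => hcon ?_⟩, hxm⟩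
  rw [hU, mem_iUnion₂] at hxU
  obtain ⟨x₀, ⟨h1, h2⟩, h3⟩ := hxU
  exact ⟨x₀, h1, h2, h3⟩

/-- A minimum principle that asks for concavity in a single direction `v` at each point off `S`.
Subtracting `η‖x‖²` makes the concavity strict, which forces the minimum onto `S`. -/
theorem nonneg_of_midpoint_le {E : Type*} [NormedAddCommGroup E] [InnerProductSpace ℝ E]
    {K S : Set E} (hK : IsCompact K) {u : E → ℝ} (hu : ContinuousOn u K)
    (hS : ∀ x ∈ K, x ∈ S → 0 ≤ u x)
    (h : ∀ x ∈ K, x ∉ S → ∃ v ≠ 0, x + v ∈ K ∧ x - v ∈ K ∧ u (x + v) + u (x - v) ≤ 2 * u x) :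
    ∀ x ∈ K, 0 ≤ u x := by
  intro x₁ hx₁
  by_contra! hneg
  obtain ⟨R, hR⟩ := hK.exists_bound_of_continuousOn (f := fun x : E => ‖x‖ ^ 2) (by fun_prop)
  have hR0 : 0 ≤ R := (norm_nonneg _).trans (hR x₁ hx₁)
  -- So small that the perturbation, at most `η * R` on `K`, cannot make up for the negative value
  -- `u x₁`.
  set η := -u x₁ / (2 * (R + 1)) with hη
  have hηpos : 0 < η := by apply div_pos <;> linarith
  have hηR : η * R < -u x₁ := by
    have : η * (2 * (R + 1)) = -u x₁ := by rw [hη]; field_simp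
    nlinarith
  obtain ⟨x₂, hx₂, hmin⟩ := hK.exists_isMinOn ⟨x₁, hx₁⟩
    (f := fun x => u x - η * ‖x‖ ^ 2) (hu.sub (by fun_prop))
  have hmin' : ∀ x ∈ K, u x₂ - η * ‖x₂‖ ^ 2 ≤ u x - η * ‖x‖ ^ 2 := fun x hx => hmin hx
  by_cases hxS : x₂ ∈ S
  · have h1 := hmin' x₁ hx₁
    have h2 := hS x₂ hx₂ hxS
    have h3 := hR x₂ hx₂
    rw [Real.norm_of_nonneg (by positivity)] at h3
    nlinarith [sq_nonneg ‖x₁‖, mul_le_mul_of_nonneg_left h3 hηpos.le,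
      mul_nonneg hηpos.le (sq_nonneg ‖x₁‖)]
  · obtain ⟨v, hv, hp, hm, hle⟩ := h x₂ hx₂ hxS
    have h1 := hmin' _ hp
    have h2 := hmin' _ hm
    have h3 := parallelogram_law_with_norm ℝ x₂ v
    have h4 : 0 < η * ‖v‖ ^ 2 := by positivity
    nlinarith

theorem exists_add_sub_mem_segment {E : Type*} [AddCommGroup E] [Module ℝ E] {x y z : E}
    (hx : x ∈ openSegment ℝ y z) (hyz : y ≠ z) :
    ∃ v ≠ 0, x + v ∈ segment ℝ y z ∧ x - v ∈ segment ℝ y z := by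
  obtain ⟨a, b, ha, hb, hab, rfl⟩ := hx
  have hc : 0 < min a b := lt_min ha hb
  refine ⟨(min a b) • (z - y), smul_ne_zero hc.ne' (sub_ne_zero.2 hyz.symm),
    ⟨a - min a b, b + min a b, by linarith [min_le_left a b], by linarith, by linarith, by module⟩,
    ⟨a + min a b, b - min a b, by linarith, by linarith [min_le_right a b], by linarith, by module⟩⟩

theorem Convex.add_smul_mem_of_add_mem {E : Type*} [AddCommGroup E] [Module ℝ E] {K : Set E}
    (hK : Convex ℝ K) {x v : E} (hx : x ∈ K) (hp : x + v ∈ K) {s : ℝ} (h0 : 0 ≤ s) (h1 : s ≤ 1) :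
    x + s • v ∈ K := by
  have := hK hx hp (sub_nonneg.2 h1) h0 (by ring)
  convert this using 1
  module

/-- Equality in the parallelogram law. Being antipodal about a centre is thus a condition on
distances, which local isometries transfer. -/
theorem sub_eq_neg_sub_of_dist {E : Type*} [NormedAddCommGroup E] [InnerProductSpace ℝ E]
    {x y z : E} {ρ : ℝ} (h1 : dist y x = ρ) (h2 : dist z x = ρ) (h3 : dist y z = 2 * ρ) :
    z - x = -(y - x) := by
  rw [dist_eq_norm] at h1 h2 h3
  have h := parallelogram_law_with_norm ℝ (y - x) (z - x)
  rw [sub_sub_sub_cancel_right, h1, h2, h3] at h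
  have h0 : ‖y - x + (z - x)‖ = 0 := by
    have : ‖y - x + (z - x)‖ * ‖y - x + (z - x)‖ = 0 := by linarith
    exact mul_self_eq_zero.1 this
  exact eq_neg_of_add_eq_zero_right (norm_eq_zero.1 h0)

theorem inner_eq_of_dist {E : Type*} [NormedAddCommGroup E] [InnerProductSpace ℝ E] (x y z : E) :
    inner ℝ (y - x) (z - x) = (dist y x ^ 2 + dist z x ^ 2 - dist y z ^ 2) / 2 := by
  rw [dist_eq_norm, dist_eq_norm, dist_eq_norm, ← sub_sub_sub_cancel_right y z x,
    norm_sub_sq_real (y - x) (z - x)]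
  ring

end Generalities

/-! ### The embedded plane and planar triangles -/

section Plane

/-- The embedding of the plane as a linear isometry. -/
noncomputable def planeInclIsometry : E2 →ₗᵢ[ℝ] E3 where
  toFun := planeIncl
  map_add' x y := by ext i; fin_cases i <;> simp [planeIncl]
  map_smul' c x := by ext i; fin_cases i <;> simp [planeIncl]
  norm_map' x := by
    simp [planeIncl, EuclideanSpace.norm_eq, Fin.sum_univ_three, Fin.sum_univ_two]

theorem planeIncl_sub (x y : E2) : planeIncl (x - y) = planeIncl x - planeIncl y :=
  planeInclIsometry.map_sub x y

theorem planeIncl_add (x y : E2) : planeIncl (x + y) = planeIncl x + planeIncl y :=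
  planeInclIsometry.map_add x y

theorem planeIncl_smul (c : ℝ) (x : E2) : planeIncl (c • x) = c • planeIncl x :=
  planeInclIsometry.map_smul c x

theorem norm_planeIncl (x : E2) : ‖planeIncl x‖ = ‖x‖ := planeInclIsometry.norm_map x

theorem dist_planeIncl (x y : E2) : dist (planeIncl x) (planeIncl y) = dist x y :=
  planeInclIsometry.dist_map x y

theorem inner_planeIncl (x y : E2) : inner ℝ (planeIncl x) (planeIncl y) = inner ℝ x y :=
  planeInclIsometry.inner_map_map x y

theorem continuous_planeIncl : Continuous planeIncl := planeInclIsometry.continuous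

theorem planeIncl_injective : Function.Injective planeIncl := planeInclIsometry.injective

theorem planeIncl_apply_two (x : E2) : planeIncl x 2 = 0 := by simp [planeIncl]

variable {p : Fin 3 → E2}

theorem isCompact_solidTriangle (p : Fin 3 → E2) : IsCompact (solidTriangle p) :=
  (finite_range p).isCompact_convexHull ℝ

theorem convex_solidTriangle (p : Fin 3 → E2) : Convex ℝ (solidTriangle p) :=
  convex_convexHull ℝ _

theorem isCompact_triSide (p : Fin 3 → E2) (k : Fin 3) : IsCompact (triSide p k) := by
  rw [triSide, ← convexHull_pair]
  exact (toFinite _).isCompact_convexHull ℝ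

theorem triSide_subset (p : Fin 3 → E2) (k : Fin 3) : triSide p k ⊆ solidTriangle p :=
  (convex_solidTriangle p).segment_subset (subset_convexHull ℝ _ (mem_range_self _))
    (subset_convexHull ℝ _ (mem_range_self _))

theorem triOpenSide_subset (p : Fin 3 → E2) (k : Fin 3) : triOpenSide p k ⊆ triSide p k :=
  openSegment_subset_segment ℝ _ _

theorem mem_triOpenSide_of_mem_triSide {k : Fin 3} {x : E2} (hx : x ∈ triSide p k)
    (hx' : x ∉ range p) : x ∈ triOpenSide p k :=
  mem_openSegment_of_ne_left_right (fun h => hx' ⟨_, h⟩) (fun h => hx' ⟨_, h⟩) hx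

/-- Extreme points of the hull are among the corners, so any other point is interior to a segment of
the triangle. On a side this direction runs along the side. -/
theorem exists_add_sub_mem_solidTriangle {x : E2} (hx : x ∈ solidTriangle p) (hx' : x ∉ range p) :
    ∃ v ≠ 0, x + v ∈ solidTriangle p ∧ x - v ∈ solidTriangle p := by
  have hne : x ∉ (solidTriangle p).extremePoints ℝ := fun h =>
    hx' (extremePoints_convexHull_subset h)
  rw [mem_extremePoints] at hne
  push Not at hne
  obtain ⟨y, hy, z, hz, hxyz, hne'⟩ := hne hx
  have hyz : y ≠ z := by
    rintro rfl
    rw [openSegment_same] at hxyz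
    exact hne' hxyz.symm hxyz.symm
  obtain ⟨v, hv, h1, h2⟩ := exists_add_sub_mem_segment hxyz hyz
  have hsub := (convex_solidTriangle p).segment_subset hy hz
  exact ⟨v, hv, hsub h1, hsub h2⟩

/-- Off the interior some barycentric coordinate vanishes, and its index names the side. -/
theorem mem_triOpenSide_of_notMem_interior (hp : AffineIndependent ℝ p) {x : E2}
    (hx : x ∈ solidTriangle p) (hx' : x ∉ range p) (hint : x ∉ interior (solidTriangle p)) :
    ∃ k, x ∈ triOpenSide p k := by
  have htop : affineSpan ℝ (range p) = ⊤ := by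
    apply hp.affineSpan_eq_top_iff_card_eq_finrank_add_one.2
    simp
  let b : AffineBasis (Fin 3) ℝ E2 := ⟨p, hp, htop⟩
  have hb : range b = range p := rfl
  have hpos : x ∈ convexHull ℝ (range b) := hx
  have hint' : x ∉ interior (convexHull ℝ (range b)) := hint
  rw [AffineBasis.convexHull_eq_nonneg_coord] at hpos
  rw [AffineBasis.interior_convexHull] at hint'
  simp only [mem_ofPred_eq, not_forall, not_lt] at hpos hint'
  obtain ⟨k, hk⟩ := hint'
  have hk0 : b.coord k x = 0 := le_antisymm hk (hpos k)
  refine ⟨k, mem_triOpenSide_of_mem_triSide ?_ hx'⟩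
  have hsum := b.sum_coord_apply_eq_one x
  have hcomb := b.linear_combination_coord_eq_self x
  have hbp : ∀ i, b i = p i := fun _ => rfl
  simp only [hbp] at hcomb
  refine ⟨b.coord (k + 1) x, b.coord (k + 2) x, hpos _, hpos _, ?_, ?_⟩
  · rw [Fin.sum_univ_three] at hsum
    fin_cases k <;> simp_all <;> linarith
  · rw [Fin.sum_univ_three] at hcomb
    conv_rhs => rw [← hcomb]
    fin_cases k <;> simp_all [add_comm]

end Plane

/-! ### Law of cosines for a dihedral angle -/

section DihedralAngle

/-- Split `Y - X` and `a - X` into components along the unit axis `E` and orthogonal to it. The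
orthogonal parts are `α • U` with `α ≥ 0`, and `V`, where `U` and `V` enclose the dihedral angle.
The planar law of cosines in the orthogonal plane gives the last term. -/
theorem norm_sub_sq_eq_dihedralAngle {P Q C a X Y E : E3} {σ s α β : ℝ} (hE : E = σ • (Q - P))
    (hE1 : ‖E‖ = 1) (hX : X - P = s • (Q - P)) (hY : Y - P = α • (C - P) + β • (Q - P))
    (hα : 0 ≤ α) :
    ‖Y - a‖ ^ 2 = ‖X - a‖ ^ 2 + ‖Y - X‖ ^ 2 + 2 * inner ℝ E (Y - X) * inner ℝ E (X - a)
      - 2 * √(‖Y - X‖ ^ 2 - inner ℝ E (Y - X) ^ 2) * √(‖X - a‖ ^ 2 - inner ℝ E (X - a) ^ 2)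
        * Real.cos (dihedralAngle P Q C a) := by
  have hσ : σ ^ 2 * ‖Q - P‖ ^ 2 = 1 := by
    rw [← sq_abs σ, ← mul_pow, ← Real.norm_eq_abs, ← norm_smul, ← hE, hE1, one_pow]
  have hσ0 : σ ≠ 0 := by rintro rfl; simp at hσ
  have hd0 : ‖Q - P‖ ^ 2 ≠ 0 := by intro h; simp [h] at hσ
  have hEE : inner ℝ E E = 1 := by rw [real_inner_self_eq_norm_sq, hE1, one_pow]
  have hd : Q - P = σ⁻¹ • E := by rw [hE, inv_smul_smul₀ hσ0]
  have hproj : ∀ w : E3, (inner ℝ (Q - P) w / ‖Q - P‖ ^ 2) • (Q - P) = inner ℝ E w • E := by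
    intro w
    have : inner ℝ E w = σ * inner ℝ (Q - P) w := by rw [hE, real_inner_smul_left]
    rw [this]
    conv_rhs => rw [hE]
    rw [smul_smul]
    congr 1
    rw [div_eq_iff hd0]
    linear_combination -(inner ℝ (Q - P) w) * hσ
  obtain ⟨U, hU⟩ : ∃ U, U = (C - P) - inner ℝ E (C - P) • E := ⟨_, rfl⟩
  obtain ⟨V, hV⟩ : ∃ V, V = (a - P) - inner ℝ E (a - P) • E := ⟨_, rfl⟩
  have hang : dihedralAngle P Q C a = InnerProductGeometry.angle U V := by
    rw [dihedralAngle, hproj, hproj, hU, hV]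
  have hEU : inner ℝ E U = 0 := by
    rw [hU, inner_sub_right, real_inner_smul_right, hEE]; ring
  have hEV : inner ℝ E V = 0 := by
    rw [hV, inner_sub_right, real_inner_smul_right, hEE]; ring
  have hUE : inner ℝ U E = 0 := by rw [real_inner_comm, hEU]
  have hVE : inner ℝ V E = 0 := by rw [real_inner_comm, hEV]
  obtain ⟨τ, hτ⟩ : ∃ τ, τ = inner ℝ E (Y - X) := ⟨_, rfl⟩
  obtain ⟨κ, hκ⟩ : ∃ κ, κ = inner ℝ E (X - a) := ⟨_, rfl⟩
  have hYX : ∃ τ' : ℝ, Y - X = α • U + τ' • E := by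
    refine ⟨α * inner ℝ E (C - P) + (β - s) * σ⁻¹, ?_⟩
    rw [← sub_sub_sub_cancel_right Y X P, hY, hX, hd, hU]
    module
  have hXa : ∃ κ' : ℝ, X - a = -V + κ' • E := by
    refine ⟨s * σ⁻¹ - inner ℝ E (a - P), ?_⟩
    rw [← sub_sub_sub_cancel_right X a P, hX, hd, hV]
    module
  obtain ⟨τ', hYX⟩ := hYX
  obtain ⟨κ', hXa⟩ := hXa
  have hτ' : τ' = τ := by
    rw [hτ, hYX, inner_add_right, real_inner_smul_right, real_inner_smul_right, hEU, hEE]; ring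
  have hκ' : κ' = κ := by
    rw [hκ, hXa, inner_add_right, inner_neg_right, real_inner_smul_right, hEV, hEE]; ring
  subst hτ' hκ'
  have n1 : ‖Y - X‖ ^ 2 = α ^ 2 * ‖U‖ ^ 2 + τ' ^ 2 := by
    rw [hYX, norm_add_sq_real, norm_smul, norm_smul, hE1, real_inner_smul_left,
      real_inner_smul_right, hUE, mul_pow, mul_one, Real.norm_eq_abs, Real.norm_eq_abs, sq_abs,
      sq_abs]
    ring
  have n2 : ‖X - a‖ ^ 2 = ‖V‖ ^ 2 + κ' ^ 2 := by
    rw [hXa, norm_add_sq_real, norm_smul, hE1, real_inner_smul_right, inner_neg_left, hVE,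
      norm_neg, mul_one, Real.norm_eq_abs, sq_abs]
    ring
  have n3 : inner ℝ (Y - X) (X - a) = -(α * inner ℝ U V) + τ' * κ' := by
    rw [hYX, hXa]
    simp only [inner_add_left, inner_add_right, real_inner_smul_left, real_inner_smul_right,
      inner_neg_right, hUE, hEV, hEE]
    ring
  have n4 : ‖Y - a‖ ^ 2 = ‖X - a‖ ^ 2 + ‖Y - X‖ ^ 2 + 2 * inner ℝ (Y - X) (X - a) := by
    rw [← sub_add_sub_cancel Y X a, norm_add_sq_real]
    ring
  have s1 : √(‖Y - X‖ ^ 2 - τ' ^ 2) = α * ‖U‖ := by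
    rw [n1, add_sub_cancel_right, ← mul_pow, Real.sqrt_sq (by positivity)]
  have s2 : √(‖X - a‖ ^ 2 - κ' ^ 2) = ‖V‖ := by
    rw [n2, add_sub_cancel_right, Real.sqrt_sq (by positivity)]
  have hcos := InnerProductGeometry.cos_angle_mul_norm_mul_norm U V
  rw [← hτ, ← hκ, s1, s2, hang, n4, n3]
  linear_combination (2 * α) * hcos

/-- The half-plane beside side `k` that contains corner `k` is convex and contains all corners. -/
theorem exists_coord_of_mem_solidTriangle {p : Fin 3 → E2} (k : Fin 3) {y : E2}
    (hy : y ∈ solidTriangle p) : ∃ α β : ℝ, 0 ≤ α ∧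
      y - p (k + 1) = α • (p k - p (k + 1)) + β • (p (k + 2) - p (k + 1)) := by
  refine convexHull_min (t := {y | ∃ α β : ℝ, 0 ≤ α ∧
      y - p (k + 1) = α • (p k - p (k + 1)) + β • (p (k + 2) - p (k + 1))}) ?_ ?_ hy
  · rintro _ ⟨i, rfl⟩
    have hi : i = k ∨ i = k + 1 ∨ i = k + 2 := by
      revert i k; decide
    rcases hi with rfl | rfl | rfl
    · exact ⟨1, 0, zero_le_one, by module⟩
    · exact ⟨0, 0, le_rfl, by module⟩
    · exact ⟨0, 1, le_rfl, by module⟩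
  · rintro x ⟨α, β, hα, hx⟩ z ⟨α', β', hα', hz⟩ s t hs ht hst
    refine ⟨s * α + t * α', s * β + t * β', by positivity, ?_⟩
    have : s • x + t • z - p (k + 1) = s • (x - p (k + 1)) + t • (z - p (k + 1)) := by
      rw [eq_sub_of_add_eq hst]; module
    rw [this, hx, hz]
    module

end DihedralAngle

/-! ### Squared distance to the apex on one face -/

namespace Couple

variable {M : Type*} [MetricSpace M] (C : Couple M)

theorem apex_height_pos (f : Fin C.T.numFaces) : 0 < C.apex f 2 :=
  (C.exists_pyramid f).choose_spec.1

theorem dist_apex_corner (f : Fin C.T.numFaces) (k : Fin 3) :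
    dist (C.apex f) (planeIncl (C.T.corner f k)) = C.r (C.T.vertex f k) :=
  (C.exists_pyramid f).choose_spec.2 k

/-- The squared distance from the apex to the point `x` of the base triangle `f`. -/
noncomputable def apexSq (f : Fin C.T.numFaces) (x : E2) : ℝ :=
  dist (C.apex f) (planeIncl x) ^ 2

theorem apexSq_corner (f : Fin C.T.numFaces) (k : Fin 3) :
    C.apexSq f (C.T.corner f k) = C.r (C.T.vertex f k) ^ 2 := by
  rw [apexSq, dist_apex_corner]

theorem continuous_apexSq (f : Fin C.T.numFaces) : Continuous (C.apexSq f) := by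
  have := continuous_planeIncl
  unfold apexSq
  fun_prop

theorem apexSq_eq (f : Fin C.T.numFaces) (x y : E2) :
    C.apexSq f y = C.apexSq f x + dist y x ^ 2
      + 2 * inner ℝ (planeIncl (y - x)) (planeIncl x - C.apex f) := by
  rw [apexSq, apexSq, dist_comm, dist_comm (C.apex f), dist_eq_norm, dist_eq_norm,
    ← sub_add_sub_cancel (planeIncl y) (planeIncl x), norm_add_sq_real, ← planeIncl_sub,
    norm_planeIncl, dist_eq_norm y x]
  ring

/-- The squared distance to the apex restricted to a straight line differs from the square of the
arc length parameter by an affine function. -/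
theorem apexSq_add_apexSq (f : Fin C.T.numFaces) {x y z : E2} {ρ : ℝ} (h1 : dist y x = ρ)
    (h2 : dist z x = ρ) (h3 : dist y z = 2 * ρ) :
    C.apexSq f y + C.apexSq f z = 2 * C.apexSq f x + 2 * ρ ^ 2 := by
  rw [C.apexSq_eq f x y, C.apexSq_eq f x z, sub_eq_neg_sub_of_dist h1 h2 h3, h1, h2,
    ← neg_one_smul ℝ (y - x), planeIncl_smul, real_inner_smul_left]
  ring

theorem apexSq_eq_baseAngle (f : Fin C.T.numFaces) (k : Fin 3) {x y e : E2} {σ : ℝ}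
    (hx : x ∈ triSide (C.T.corner f) k) (hy : y ∈ C.T.tri f)
    (he : e = σ • (C.T.corner f (k + 2) - C.T.corner f (k + 1))) (he1 : ‖e‖ = 1) :
    C.apexSq f y = C.apexSq f x + dist y x ^ 2
      + 2 * inner ℝ e (y - x) * inner ℝ (planeIncl e) (planeIncl x - C.apex f)
      - 2 * √(dist y x ^ 2 - inner ℝ e (y - x) ^ 2)
        * √(C.apexSq f x - inner ℝ (planeIncl e) (planeIncl x - C.apex f) ^ 2)
        * Real.cos (C.baseAngle f k) := by
  obtain ⟨a, b, -, -, hab, hx⟩ := hx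
  obtain ⟨α, β, hα, hy⟩ := exists_coord_of_mem_solidTriangle k hy
  have h := norm_sub_sq_eq_dihedralAngle (P := planeIncl (C.T.corner f (k + 1)))
    (Q := planeIncl (C.T.corner f (k + 2))) (C := planeIncl (C.T.corner f k)) (a := C.apex f)
    (X := planeIncl x) (Y := planeIncl y) (E := planeIncl e) (σ := σ) (s := b) (α := α) (β := β)
    (by rw [he, planeIncl_smul, planeIncl_sub]) (by rw [norm_planeIncl, he1])
    (by
      rw [← planeIncl_sub, ← planeIncl_sub, ← planeIncl_smul, ← hx, eq_sub_of_add_eq hab]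
      congr 1
      module)
    (by rw [← planeIncl_sub, ← planeIncl_sub, ← planeIncl_sub, ← planeIncl_smul, ← planeIncl_smul,
      ← planeIncl_add, hy]) hα
  rw [← planeIncl_sub, inner_planeIncl, norm_planeIncl, ← dist_eq_norm, ← dist_eq_norm,
    ← dist_eq_norm, dist_comm, dist_comm _ (C.apex f)] at h
  exact h

end Couple

/-! ### Limits along fibres and segments -/

section Generalities

theorem eventually_dist_lt_of_fiber {X Y : Type*} [PseudoMetricSpace X] [TopologicalSpace Y]
    [T2Space Y] {K : Set X} (hK : IsCompact K) {φ : X → Y} (hφ : ContinuousOn φ K) {F : X → ℝ}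
    (hF : Continuous F) {m : Y} {c : ℝ} (hc : ∀ x ∈ K, φ x = m → F x = c) {ε : ℝ} (hε : 0 < ε) :
    ∀ᶠ m' in 𝓝 m, ∀ x ∈ K, φ x = m' → dist (F x) c < ε := by
  choose δ hδ hδF using fun x => Metric.continuous_iff.1 hF x ε hε
  filter_upwards [eventually_forall_preimage_near hK hφ (ε := δ) m fun x _ _ => hδ x]
    with m' hm' x hx hxm
  obtain ⟨x₀, h1, h2, h3⟩ := hm' x hx hxm
  rw [← hc x₀ h1 h2]
  exact hδF _ _ h3

theorem tendsto_add_smul_nhdsGT {E : Type*} [NormedAddCommGroup E] [NormedSpace ℝ E] (x v : E) :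
    Tendsto (fun s : ℝ => x + s • v) (𝓝[>] 0) (𝓝 x) := by
  have : Continuous fun s : ℝ => x + s • v := by fun_prop
  simpa using (this.tendsto 0).mono_left nhdsWithin_le_nhds

theorem tendsto_comp_add_smul_nhdsGT {E Y : Type*} [NormedAddCommGroup E] [NormedSpace ℝ E]
    [TopologicalSpace Y] {K : Set E} (hK : Convex ℝ K) {φ : E → Y} (hφ : ContinuousOn φ K) {x v : E}
    (hx : x ∈ K) (hv : x + v ∈ K) :
    Tendsto (fun s : ℝ => φ (x + s • v)) (𝓝[>] 0) (𝓝 (φ x)) := by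
  refine (hφ x hx).tendsto.comp (tendsto_nhdsWithin_iff.2 ⟨tendsto_add_smul_nhdsGT x v, ?_⟩)
  filter_upwards [Ioo_mem_nhdsGT (zero_lt_one' ℝ)] with s hs
  exact hK.add_smul_mem_of_add_mem hx hv hs.1.le hs.2.le

end Generalities

/-! ### Local structure of a triangulation -/

namespace GeodesicTriangulation

variable {M : Type*} [MetricSpace M] (T : GeodesicTriangulation M)

theorem exists_isoRadius : ∃ ε : Fin T.numFaces → E2 → ℝ, (∀ f x, 0 < ε f x) ∧
    ∀ f, ∀ x ∈ T.tri f, x ∉ range (T.corner f) → ∀ y ∈ T.tri f, dist y x < ε f x →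
      ∀ z ∈ T.tri f, dist z x < ε f x → dist (T.toM f y) (T.toM f z) = dist y z := by
  have h : ∀ f x, ∃ ε : ℝ, 0 < ε ∧ (x ∈ T.tri f → x ∉ range (T.corner f) → ∀ y ∈ T.tri f,
      dist y x < ε → ∀ z ∈ T.tri f, dist z x < ε → dist (T.toM f y) (T.toM f z) = dist y z) := by
    intro f x
    by_cases hx : x ∈ T.tri f ∧ x ∉ range (T.corner f)
    · obtain ⟨ε, hε, h⟩ := T.local_isometry f x hx.1 hx.2
      exact ⟨ε, hε, fun _ _ y hy hyx z hz hzx => h y ⟨hy, hyx⟩ z ⟨hz, hzx⟩⟩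
    -- The value at corners and outside the triangle is arbitrary; a total positive function keeps
    -- the compactness lemmas applicable.
    · exact ⟨1, one_pos, fun h1 h2 => absurd ⟨h1, h2⟩ hx⟩
  choose ε hε hiso using h
  exact ⟨ε, hε, hiso⟩

theorem isCompact_tri (f : Fin T.numFaces) : IsCompact (T.tri f) := isCompact_solidTriangle _

theorem convex_tri (f : Fin T.numFaces) : Convex ℝ (T.tri f) := convex_solidTriangle _

theorem mem_tri_of_mem_side {f : Fin T.numFaces} {k : Fin 3} {x : E2}
    (hx : x ∈ triSide (T.corner f) k) : x ∈ T.tri f := triSide_subset _ _ hx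

theorem eventually_preimage_near {ε : Fin T.numFaces → E2 → ℝ} (hε : ∀ f x, 0 < ε f x) (m : M) :
    ∀ᶠ m' in 𝓝 m, ∀ f, ∀ x ∈ T.tri f, T.toM f x = m' →
      ∃ x₀ ∈ T.tri f, T.toM f x₀ = m ∧ dist x x₀ < ε f x₀ :=
  eventually_all.2 fun f => eventually_forall_preimage_near (T.isCompact_tri f)
    (T.continuousOn f) m fun x _ _ => hε f x

theorem eventually_side_preimage_near {ε : Fin T.numFaces → E2 → ℝ} (hε : ∀ f x, 0 < ε f x)
    (m : M) (f : Fin T.numFaces) (k : Fin 3) :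
    ∀ᶠ m' in 𝓝 m, ∀ x ∈ triSide (T.corner f) k, T.toM f x = m' →
      ∃ x₀ ∈ triSide (T.corner f) k, T.toM f x₀ = m ∧ dist x x₀ < ε f x₀ :=
  eventually_forall_preimage_near (isCompact_triSide _ _)
    ((T.continuousOn f).mono (triSide_subset _ _)) m fun x _ _ => hε f x

/-- Being a vertex is intrinsic: it means being singular in `M`. -/
theorem notMem_range_corner {f g : Fin T.numFaces} {x y : E2} (hx : x ∈ T.tri f) (hy : y ∈ T.tri g)
    (h : T.toM f x = T.toM g y) (hxc : x ∉ range (T.corner f)) : y ∉ range (T.corner g) := by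
  rw [← T.vertex_iff f x hx, h] at hxc
  rwa [← T.vertex_iff g y hy]

theorem eq_of_mem_side {f : Fin T.numFaces} {k : Fin 3} {x y : E2}
    (hx : x ∈ triSide (T.corner f) k) (hy : y ∈ triSide (T.corner f) k)
    (h : T.toM f x = T.toM f y) (hxc : x ∉ range (T.corner f)) : x = y :=
  T.side_injOn f k (mem_triOpenSide_of_mem_triSide hx hxc)
    (mem_triOpenSide_of_mem_triSide hy
      (T.notMem_range_corner (T.mem_tri_of_mem_side hx) (T.mem_tri_of_mem_side hy) h hxc)) h

theorem corner_ne (f : Fin T.numFaces) (k : Fin 3) : T.corner f (k + 1) ≠ T.corner f (k + 2) := by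
  intro h
  have := (T.nondegenerate f).injective h
  clear h
  fin_cases k <;> simp at this

end GeodesicTriangulation

/-! ### The squared distance descends to `M` -/

namespace Couple

variable {M : Type*} [MetricSpace M] (C : Couple M)

theorem apexSq_eq_of_singular {f : Fin C.T.numFaces} {x : E2} (hx : x ∈ C.T.tri f)
    (hs : C.T.toM f x ∈ singularSet M) : C.apexSq f x = C.r ⟨C.T.toM f x, hs⟩ ^ 2 := by
  obtain ⟨k, rfl⟩ := (C.T.vertex_iff f x hx).1 hs
  exact C.apexSq_corner f k

theorem apexSq_eq_of_corner {f g : Fin C.T.numFaces} {x y : E2} (hx : x ∈ C.T.tri f)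
    (hy : y ∈ C.T.tri g) (h : C.T.toM f x = C.T.toM g y) (hxc : x ∈ range (C.T.corner f)) :
    C.apexSq f x = C.apexSq g y := by
  have hs := (C.T.vertex_iff f x hx).2 hxc
  rw [C.apexSq_eq_of_singular hx hs, C.apexSq_eq_of_singular hy (h ▸ hs)]
  simp only [h]

/-- Along an edge, both functions are squared arc length plus an affine function, and the radii make
them agree at the ends. Their difference has zero second differences locally, so the minimum
principle applies. Exchanging the sides gives the reverse inequality. -/
theorem apexSq_le_of_edge_eq {f g : Fin C.T.numFaces} {k l : Fin 3}
    (he : C.T.edge f k = C.T.edge g l) {x y : E2} (hx : x ∈ triSide (C.T.corner f) k)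
    (hy : y ∈ triSide (C.T.corner g) l) (h : C.T.toM f x = C.T.toM g y) :
    C.apexSq g y ≤ C.apexSq f x := by
  have hex : ∀ x, ∃ y, x ∈ triSide (C.T.corner f) k →
      y ∈ triSide (C.T.corner g) l ∧ C.T.toM g y = C.T.toM f x := by
    intro x
    by_cases hx : x ∈ triSide (C.T.corner f) k
    · have : C.T.toM f x ∈ C.T.edge g l := he ▸ mem_image_of_mem _ hx
      obtain ⟨y, hy, hxy⟩ := this
      exact ⟨y, fun _ => ⟨hy, hxy⟩⟩
    · exact ⟨0, fun h => absurd h hx⟩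
  -- `φ` carries one side to the other through `M`. At an end of a loop the choice is ambiguous, but
  -- the value of `apexSq` is not, which is why continuity is shown for the composite only.
  choose φ hφ using hex
  have hside := fun {f k x} (h : x ∈ triSide (C.T.corner f) k) => C.T.mem_tri_of_mem_side h
  have huniq : ∀ y ∈ triSide (C.T.corner g) l, ∀ y' ∈ triSide (C.T.corner g) l,
      C.T.toM g y = C.T.toM g y' → C.apexSq g y = C.apexSq g y' := by
    intro y hy y' hy' hyy'
    by_cases hc : y ∈ range (C.T.corner g)
    · exact C.apexSq_eq_of_corner (hside hy) (hside hy') hyy' hc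
    · rw [C.T.eq_of_mem_side hy hy' hyy' hc]
  have hfc : ContinuousOn (C.T.toM f) (triSide (C.T.corner f) k) :=
    (C.T.continuousOn f).mono (triSide_subset _ _)
  have hgc : ContinuousOn (C.T.toM g) (triSide (C.T.corner g) l) :=
    (C.T.continuousOn g).mono (triSide_subset _ _)
  have hcont : ContinuousOn (fun x => C.apexSq g (φ x)) (triSide (C.T.corner f) k) := by
    intro x₀ hx₀
    refine Metric.tendsto_nhds.2 fun ε hε => ?_
    have := eventually_dist_lt_of_fiber (isCompact_triSide _ l) hgc (C.continuous_apexSq g)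
      (m := C.T.toM f x₀) (c := C.apexSq g (φ x₀))
      (fun y hy hym => huniq y hy _ (hφ x₀ hx₀).1 (hym.trans (hφ x₀ hx₀).2.symm)) hε
    filter_upwards [(hfc x₀ hx₀).tendsto.eventually this, self_mem_nhdsWithin] with x hx hxK
    exact hx _ (hφ x hxK).1 (hφ x hxK).2
  have key := nonneg_of_midpoint_le (isCompact_triSide (C.T.corner f) k)
    (u := fun x => C.apexSq f x - C.apexSq g (φ x)) (S := range (C.T.corner f))
    ((C.continuous_apexSq f).continuousOn.sub hcont) ?_ ?_ x hx
  · rw [huniq y hy _ (hφ x hx).1 (h.symm.trans (hφ x hx).2.symm)]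
    linarith
  · intro x hx hxc
    rw [C.apexSq_eq_of_corner (hside hx) (hside (hφ x hx).1) (hφ x hx).2.symm hxc, sub_self]
  · intro x hx hxc
    obtain ⟨v, hv, hp, hm⟩ := exists_add_sub_mem_segment (mem_triOpenSide_of_mem_triSide hx hxc)
      (C.T.corner_ne f k)
    rw [sub_eq_add_neg] at hm
    have hK : Convex ℝ (triSide (C.T.corner f) k) := convex_segment _ _
    obtain ⟨ε, hε, hiso⟩ := C.T.exists_isoRadius
    have hyc := C.T.notMem_range_corner (hside hx) (hside (hφ x hx).1) (hφ x hx).2.symm hxc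
    have hnear := C.T.eventually_side_preimage_near hε (C.T.toM f x) g l
    have hx0 : ball x (ε f x) ∈ 𝓝 x := ball_mem_nhds _ (hε f x)
    have hIoo : ∀ᶠ s in 𝓝[>] (0 : ℝ), s ∈ Ioo 0 1 := Ioo_mem_nhdsGT zero_lt_one
    obtain ⟨s, hs, h1, h2, h3, h4⟩ := (hIoo.and (((tendsto_add_smul_nhdsGT x v).eventually hx0).and
      (((tendsto_add_smul_nhdsGT x (-v)).eventually hx0).and
      (((tendsto_comp_add_smul_nhdsGT hK hfc hx hp).eventually hnear).and
      ((tendsto_comp_add_smul_nhdsGT hK hfc hx hm).eventually hnear))))).exists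
    have hp' := hK.add_smul_mem_of_add_mem hx hp hs.1.le hs.2.le
    have hm' := hK.add_smul_mem_of_add_mem hx hm hs.1.le hs.2.le
    -- The nearby preimage supplied by compactness must be `φ x`, since a side is injective away
    -- from vertices.
    have n1 : dist (φ (x + s • v)) (φ x) < ε g (φ x) := by
      obtain ⟨y, hy, hym, hd⟩ := h3 _ (hφ _ hp').1 (hφ _ hp').2
      rwa [C.T.eq_of_mem_side (hφ x hx).1 hy ((hφ x hx).2.trans hym.symm) hyc]
    have n2 : dist (φ (x + s • -v)) (φ x) < ε g (φ x) := by
      obtain ⟨y, hy, hym, hd⟩ := h4 _ (hφ _ hm').1 (hφ _ hm').2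
      rwa [C.T.eq_of_mem_side (hφ x hx).1 hy ((hφ x hx).2.trans hym.symm) hyc]
    have hxx : dist x x < ε f x := by rw [dist_self]; exact hε f x
    have hyy : dist (φ x) (φ x) < ε g (φ x) := by rw [dist_self]; exact hε g _
    have e1 := hiso f x (hside hx) hxc _ (hside hp') h1 _ (hside hx) hxx
    have e2 := hiso f x (hside hx) hxc _ (hside hm') h2 _ (hside hx) hxx
    have e3 := hiso f x (hside hx) hxc _ (hside hp') h1 _ (hside hm') h2
    have gh := fun x hx => hside (hφ x hx).1
    have e1' := hiso g _ (gh x hx) hyc _ (gh _ hp') n1 _ (gh _ hx) hyy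
    have e2' := hiso g _ (gh x hx) hyc _ (gh _ hm') n2 _ (gh _ hx) hyy
    have e3' := hiso g _ (gh x hx) hyc _ (gh _ hp') n1 _ (gh _ hm') n2
    rw [(hφ _ hp').2, (hφ _ hx).2] at e1'
    rw [(hφ _ hm').2, (hφ _ hx).2] at e2'
    rw [(hφ _ hp').2, (hφ _ hm').2] at e3'
    have d1 : dist (x + s • v) x = s * ‖v‖ := by
      rw [dist_eq_norm, add_sub_cancel_left, norm_smul, Real.norm_of_nonneg hs.1.le]
    have d2 : dist (x + s • -v) x = s * ‖v‖ := by
      rw [dist_eq_norm, add_sub_cancel_left, norm_smul, Real.norm_of_nonneg hs.1.le, norm_neg]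
    have d3 : dist (x + s • v) (x + s • -v) = 2 * (s * ‖v‖) := by
      rw [dist_eq_norm, show x + s • v - (x + s • -v) = (2 * s) • v by module, norm_smul,
        Real.norm_of_nonneg (by linarith [hs.1]), mul_assoc]
    have q1 := C.apexSq_add_apexSq f d1 d2 d3
    have q2 := C.apexSq_add_apexSq g (e1'.symm.trans (e1.trans d1)) (e2'.symm.trans (e2.trans d2))
      (e3'.symm.trans (e3.trans d3))
    refine ⟨s • v, smul_ne_zero hs.1.ne' hv, hp', ?_, ?_⟩
    · simpa [sub_eq_add_neg] using hm'
    · rw [sub_eq_add_neg x, ← smul_neg]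
      linarith

/-- The squared distance to the apex is a well-defined function on `M`. -/
theorem apexSq_eq_of_toM_eq {f g : Fin C.T.numFaces} {x y : E2} (hx : x ∈ C.T.tri f)
    (hy : y ∈ C.T.tri g) (h : C.T.toM f x = C.T.toM g y) : C.apexSq f x = C.apexSq g y := by
  by_cases hxc : x ∈ range (C.T.corner f)
  · exact C.apexSq_eq_of_corner hx hy h hxc
  have hyc := C.T.notMem_range_corner hx hy h hxc
  by_cases hxi : x ∈ interior (solidTriangle (C.T.corner f))
  · obtain ⟨rfl, rfl⟩ := C.T.interior_unique f g x hxi y hy h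
    rfl
  by_cases hyi : y ∈ interior (solidTriangle (C.T.corner g))
  · obtain ⟨rfl, rfl⟩ := C.T.interior_unique g f y hyi x hx h.symm
    rfl
  obtain ⟨k, hk⟩ := mem_triOpenSide_of_notMem_interior (C.T.nondegenerate f) hx hxc hxi
  obtain ⟨l, hl⟩ := mem_triOpenSide_of_notMem_interior (C.T.nondegenerate g) hy hyc hyi
  have he : C.T.edge f k = C.T.edge g l := C.T.side_match f k g l x hk y hl h
  exact le_antisymm
    (C.apexSq_le_of_edge_eq he.symm (triOpenSide_subset _ _ hl) (triOpenSide_subset _ _ hk) h.symm)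
    (C.apexSq_le_of_edge_eq he (triOpenSide_subset _ _ hk) (triOpenSide_subset _ _ hl) h)

/-- The squared distance to the apex as a function on the boundary `M`. -/
noncomputable def sqDist (m : M) : ℝ :=
  C.apexSq (C.T.covers m).choose (C.T.covers m).choose_spec.choose

theorem sqDist_toM {f : Fin C.T.numFaces} {x : E2} (hx : x ∈ C.T.tri f) :
    C.sqDist (C.T.toM f x) = C.apexSq f x :=
  have h := (C.T.covers (C.T.toM f x)).choose_spec.choose_spec
  C.apexSq_eq_of_toM_eq h.1 hx h.2

theorem sqDist_of_singular {m : M} (hm : m ∈ singularSet M) : C.sqDist m = C.r ⟨m, hm⟩ ^ 2 := by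
  obtain ⟨f, x, hx, rfl⟩ := C.T.covers m
  rw [C.sqDist_toM hx, C.apexSq_eq_of_singular hx hm]

theorem continuous_sqDist : Continuous C.sqDist := by
  refine continuous_iff_continuousAt.2 fun m => Metric.tendsto_nhds.2 fun ε hε => ?_
  have h : ∀ᶠ m' in 𝓝 m, ∀ f, ∀ x ∈ C.T.tri f, C.T.toM f x = m' →
      dist (C.apexSq f x) (C.sqDist m) < ε :=
    eventually_all.2 fun f => eventually_dist_lt_of_fiber (C.T.isCompact_tri f) (C.T.continuousOn f)
      (C.continuous_apexSq f) (fun x hx hxm => by rw [← hxm, C.sqDist_toM hx]) hε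
  filter_upwards [h] with m' hm'
  obtain ⟨f, x, hx, rfl⟩ := C.T.covers m'
  rw [C.sqDist_toM hx]
  exact hm' f x hx rfl

end Couple

theorem mem_range_toM_of_ball {M : Type*} [MetricSpace M] {c : E2 → M} {m m' : M} {ε ρ : ℝ}
    (hc : c '' ball (0 : E2) ε = ball m ε) (h : dist m' m = ρ) (hρ : ρ < ε) :
    ∃ w ∈ ball (0 : E2) ε, c w = m' := by
  have : m' ∈ c '' ball (0 : E2) ε := by rw [hc, mem_ball, h]; exact hρ
  exact this

/-! ### Convexity and comparison of squared distances -/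

namespace Couple

variable {M : Type*} [MetricSpace M] (C : Couple M)

theorem baseAngle_nonneg (f : Fin C.T.numFaces) (k : Fin 3) : 0 ≤ C.baseAngle f k :=
  InnerProductGeometry.angle_nonneg _ _

/-- All summands of `theta` are nonnegative, so two distinct sides bound it from below; how many
sides carry the edge need not be known. -/
theorem baseAngle_add_le_theta {f g : Fin C.T.numFaces} {k l : Fin 3}
    (he : C.T.edge f k = C.T.edge g l) (hne : (f, k) ≠ (g, l)) :
    C.baseAngle f k + C.baseAngle g l ≤ C.theta f k := by
  classical
  have h0 : ∀ s ∈ (Finset.univ : Finset (Fin C.T.numFaces × Fin 3)),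
      0 ≤ if C.T.edge s.1 s.2 = C.T.edge f k then C.baseAngle s.1 s.2 else 0 := by
    intro s _
    split_ifs
    · exact C.baseAngle_nonneg _ _
    · exact le_rfl
  have h := Finset.add_le_sum h0 (Finset.mem_univ (f, k)) (Finset.mem_univ (g, l)) hne
  rw [if_pos rfl, if_pos he.symm] at h
  exact h

/-- The only place where convexity enters: `α ≤ π - β` gives `cos α ≥ -cos β`. -/
theorem IsConvex.cos_add_cos_nonneg {C : Couple M} (hC : C.IsConvex) {f g : Fin C.T.numFaces}
    {k l : Fin 3} (he : C.T.edge f k = C.T.edge g l) (hne : (f, k) ≠ (g, l)) :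
    0 ≤ Real.cos (C.baseAngle f k) + Real.cos (C.baseAngle g l) := by
  have h := (C.baseAngle_add_le_theta he hne).trans (hC f k)
  have := Real.cos_le_cos_of_nonneg_of_le_pi (C.baseAngle_nonneg f k)
    (y := Real.pi - C.baseAngle g l) (by linarith [C.baseAngle_nonneg g l]) (by linarith)
  rw [Real.cos_pi_sub] at this
  linarith

/-- Apply the dihedral law of cosines on both sides of the edge. Antipodal points have opposite
components along the edge, so the linear terms cancel. The square roots agree, leaving `cos α + cos
β` with a nonpositive factor. -/
theorem IsConvex.apexSq_add_le_of_edge {C : Couple M} (hC : C.IsConvex) {m : M}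
    {f g : Fin C.T.numFaces} {k l : Fin 3}
    (hne : (f, k) ≠ (g, l)) {x y : E2} (hx : x ∈ triOpenSide (C.T.corner f) k)
    (hxc : x ∉ range (C.T.corner f))
    (hy : y ∈ triOpenSide (C.T.corner g) l) (hxm : C.T.toM f x = m) (hym : C.T.toM g y = m)
    {ε : Fin C.T.numFaces → E2 → ℝ} (hε : ∀ f x, 0 < ε f x)
    (hiso : ∀ f, ∀ x ∈ C.T.tri f, x ∉ range (C.T.corner f) → ∀ y ∈ C.T.tri f, dist y x < ε f x →
      ∀ z ∈ C.T.tri f, dist z x < ε f x → dist (C.T.toM f y) (C.T.toM f z) = dist y z)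
    {c : E2 → M} {ε₀ : ℝ} (hε₀ : 0 < ε₀) (hc0 : c 0 = m)
    (hc : ∀ y ∈ ball (0 : E2) ε₀, ∀ z ∈ ball (0 : E2) ε₀, dist (c y) (c z) = dist y z)
    (himg : c '' ball (0 : E2) ε₀ = ball m ε₀)
    {x₁ y₁ : E2} (hx₁ : x₁ ∈ C.T.tri f) (hy₁ : y₁ ∈ C.T.tri g) (hxx : dist x₁ x < ε f x)
    (hyy : dist y₁ y < ε g y) {ρ : ℝ} (hρ : ρ < ε₀) (h1 : dist (C.T.toM f x₁) m = ρ)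
    (h2 : dist (C.T.toM g y₁) m = ρ) (h3 : dist (C.T.toM f x₁) (C.T.toM g y₁) = 2 * ρ) :
    C.apexSq f x₁ + C.apexSq g y₁ ≤ 2 * C.apexSq f x + 2 * ρ ^ 2 := by
  have hxs := triOpenSide_subset _ _ hx
  have hys := triOpenSide_subset _ _ hy
  have hxt := C.T.mem_tri_of_mem_side hxs
  have hyt := C.T.mem_tri_of_mem_side hys
  have hxy : C.T.toM f x = C.T.toM g y := hxm.trans hym.symm
  have hyc := C.T.notMem_range_corner hxt hyt hxy hxc
  have he : C.T.edge f k = C.T.edge g l := C.T.side_match f k g l x hx y hy hxy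
  have hxx0 : dist x x < ε f x := by rw [dist_self]; exact hε f x
  have hyy0 : dist y y < ε g y := by rw [dist_self]; exact hε g y
  -- A second point of the edge near `m`, seen as `x₂` in `f` and as `y₂` in `g`, fixes one edge
  -- direction for both faces.
  obtain ⟨v, hv, hp, -⟩ := exists_add_sub_mem_segment hx (C.T.corner_ne f k)
  have hK : Convex ℝ (triSide (C.T.corner f) k) := convex_segment _ _
  have hfc : ContinuousOn (C.T.toM f) (triSide (C.T.corner f) k) :=
    (C.T.continuousOn f).mono (triSide_subset _ _)
  have hIoo : ∀ᶠ s in 𝓝[>] (0 : ℝ), s ∈ Ioo 0 1 := Ioo_mem_nhdsGT zero_lt_one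
  have hT := tendsto_comp_add_smul_nhdsGT hK hfc hxs hp
  obtain ⟨s, hs, hs1, hs2, hs3⟩ := (hIoo.and
    (((tendsto_add_smul_nhdsGT x v).eventually (ball_mem_nhds _ (hε f x))).and
    ((hT.eventually (C.T.eventually_side_preimage_near hε (C.T.toM f x) g l)).and
    (hT.eventually (ball_mem_nhds _ hε₀))))).exists
  have hx₂ : x + s • v ∈ triSide (C.T.corner f) k :=
    hK.add_smul_mem_of_add_mem hxs hp hs.1.le hs.2.le
  obtain ⟨x₂, hx₂_def⟩ : ∃ x₂, x₂ = x + s • v := ⟨_, rfl⟩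
  rw [← hx₂_def] at hs1 hs2 hs3 hx₂
  have hx₂x : x₂ ≠ x := by
    rw [hx₂_def]
    simpa using And.intro hs.1.ne' hv
  obtain ⟨y₂, hy₂, hxy₂⟩ : C.T.toM f x₂ ∈ C.T.edge g l := he ▸ mem_image_of_mem _ hx₂
  have hs2' : dist y₂ y < ε g y := by
    obtain ⟨y', hy', hym', hd⟩ := hs2 y₂ hy₂ hxy₂
    rwa [C.T.eq_of_mem_side hys hy' (hxy.symm.trans hym'.symm) hyc]
  have hx₂t := C.T.mem_tri_of_mem_side hx₂
  have hy₂t := C.T.mem_tri_of_mem_side hy₂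
  obtain ⟨δ, hδ⟩ : ∃ δ, δ = dist x₂ x := ⟨_, rfl⟩
  have hδ0 : 0 < δ := hδ ▸ dist_pos.2 hx₂x
  have hxiso := hiso f x hxt hxc
  have hyiso := hiso g y hyt hyc
  have hmδ : dist (C.T.toM f x₂) m = δ := by
    rw [← hxm, hxiso _ hx₂t hs1 _ hxt hxx0, hδ]
  have hδ' : dist y₂ y = δ := by
    rw [← hyiso _ hy₂t hs2' _ hyt hyy0, hxy₂, ← hxy, hxm, hmδ]
  -- the chart at the regular point
  obtain ⟨w₁, hw₁, hcw₁⟩ := mem_range_toM_of_ball himg h1 hρ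
  obtain ⟨w₂, hw₂, hcw₂⟩ := mem_range_toM_of_ball himg h2 hρ
  obtain ⟨d, hd, hcd⟩ := mem_range_toM_of_ball himg (m' := C.T.toM f x₂) rfl
    (by rw [← hxm]; exact hs3)
  have h00 : (0 : E2) ∈ ball (0 : E2) ε₀ := mem_ball_self hε₀
  have hw : w₂ - 0 = -(w₁ - 0) := sub_eq_neg_sub_of_dist (ρ := ρ)
    (by rw [← hc _ hw₁ _ h00, hcw₁, hc0, h1]) (by rw [← hc _ hw₂ _ h00, hcw₂, hc0, h2])
    (by rw [← hc _ hw₁ _ hw₂, hcw₁, hcw₂, h3])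
  have i1 : inner ℝ (x₂ - x) (x₁ - x) = inner ℝ (d - 0) (w₁ - 0) := by
    rw [inner_eq_of_dist, inner_eq_of_dist, ← hc _ hd _ h00, ← hc _ hw₁ _ h00, ← hc _ hd _ hw₁,
      hcd, hcw₁, hc0, ← hxm, hxiso _ hx₂t hs1 _ hxt hxx0, hxiso _ hx₁ hxx _ hxt hxx0,
      hxiso _ hx₂t hs1 _ hx₁ hxx]
  have i2 : inner ℝ (y₂ - y) (y₁ - y) = inner ℝ (d - 0) (w₂ - 0) := by
    rw [inner_eq_of_dist, inner_eq_of_dist, ← hc _ hd _ h00, ← hc _ hw₂ _ h00, ← hc _ hd _ hw₂,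
      hcd, hcw₂, hc0, ← hym, ← hxy₂, hyiso _ hy₂t hs2' _ hyt hyy0, hyiso _ hy₁ hyy _ hyt hyy0,
      hyiso _ hy₂t hs2' _ hy₁ hyy]
  have i3 : inner ℝ (y₂ - y) (y₁ - y) = -inner ℝ (x₂ - x) (x₁ - x) := by
    rw [i1, i2, hw, inner_neg_right]
  -- the formulas at the two sides
  have hunit : ∀ {u w : E2}, dist u w = δ → ‖δ⁻¹ • (u - w)‖ = 1 := by
    intro u w h
    rw [norm_smul, ← dist_eq_norm, h, norm_inv, Real.norm_of_nonneg hδ0.le,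
      inv_mul_cancel₀ hδ0.ne']
  have hdir : ∀ {p q u w : E2}, u ∈ segment ℝ p q → w ∈ segment ℝ p q →
      ∃ σ : ℝ, δ⁻¹ • (u - w) = σ • (q - p) := by
    rintro p q _ _ ⟨a, b, -, -, hab, rfl⟩ ⟨a', b', -, -, hab', rfl⟩
    refine ⟨δ⁻¹ * (b - b'), ?_⟩
    rw [eq_sub_of_add_eq hab, eq_sub_of_add_eq hab']
    module
  obtain ⟨σ, hσ⟩ := hdir hx₂ hxs
  obtain ⟨σ', hσ'⟩ := hdir hy₂ hys
  have F := C.apexSq_eq_baseAngle f k hxs hx₁ hσ (hunit hδ.symm)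
  have G := C.apexSq_eq_baseAngle g l hys hy₁ hσ' (hunit hδ')
  have q0 : C.apexSq f x = C.apexSq g y := C.apexSq_eq_of_toM_eq hxt hyt hxy
  -- Comparing the two expansions at this second point shows that both apices have the same
  -- component along the edge.
  have q2 : C.apexSq f x₂ = C.apexSq g y₂ := C.apexSq_eq_of_toM_eq hx₂t hy₂t hxy₂.symm
  rw [C.apexSq_eq f x x₂, C.apexSq_eq g y y₂, q0, ← hδ, hδ'] at q2
  have d1 : dist x₁ x = ρ := by rw [← hxiso _ hx₁ hxx _ hxt hxx0, hxm, h1]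
  have d2 : dist y₁ y = ρ := by rw [← hyiso _ hy₁ hyy _ hyt hyy0, hym, h2]
  rw [d1, real_inner_smul_left, planeIncl_smul, real_inner_smul_left] at F
  rw [d2, real_inner_smul_left, planeIncl_smul, real_inner_smul_left, ← q0, i3,
    show inner ℝ (planeIncl (y₂ - y)) (planeIncl y - C.apex g)
      = inner ℝ (planeIncl (x₂ - x)) (planeIncl x - C.apex f) by linarith,
    mul_neg, neg_sq] at G
  have hcos := hC.cos_add_cos_nonneg he hne
  rw [F, G]
  have := mul_nonneg (mul_nonneg
    (Real.sqrt_nonneg (ρ ^ 2 - (δ⁻¹ * inner ℝ (x₂ - x) (x₁ - x)) ^ 2))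
    (Real.sqrt_nonneg (C.apexSq f x -
      (δ⁻¹ * inner ℝ (planeIncl (x₂ - x)) (planeIncl x - C.apex f)) ^ 2))) hcos
  linarith

/-- The squared distance to the apex of a convex couple is locally at most as convex as the squared
distance in the plane. -/
theorem IsConvex.exists_sqDist_add_le {C : Couple M} (hC : C.IsConvex) {m : M}
    (hreg : IsRegularPoint m) (hs : m ∉ singularSet M) :
    ∃ ε > 0, ∀ ρ < ε, ∀ m₁ m₂ : M, dist m₁ m = ρ → dist m₂ m = ρ → dist m₁ m₂ = 2 * ρ →
      C.sqDist m₁ + C.sqDist m₂ ≤ 2 * C.sqDist m + 2 * ρ ^ 2 := by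
  obtain ⟨ε, hε, hiso⟩ := C.T.exists_isoRadius
  obtain ⟨ε₁, hε₁, hnear⟩ := Metric.eventually_nhds_iff.1 (C.T.eventually_preimage_near hε m)
  obtain ⟨ε₀, hε₀, c, hc0, hc, himg⟩ := hreg
  refine ⟨min ε₀ ε₁, lt_min hε₀ hε₁, fun ρ hρ m₁ m₂ h1 h2 h3 => ?_⟩
  obtain ⟨f, x₁, hx₁, rfl⟩ := C.T.covers m₁
  obtain ⟨g, y₁, hy₁, rfl⟩ := C.T.covers m₂
  have hρ₁ : ρ < ε₁ := hρ.trans_le (min_le_right _ _)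
  obtain ⟨x, hx, hxm, hxx⟩ := hnear (h1.trans_lt hρ₁) f x₁ hx₁ rfl
  obtain ⟨y, hy, hym, hyy⟩ := hnear (h2.trans_lt hρ₁) g y₁ hy₁ rfl
  have hxc : x ∉ range (C.T.corner f) := by rwa [← C.T.vertex_iff f x hx, hxm]
  have hyc : y ∉ range (C.T.corner g) := by rwa [← C.T.vertex_iff g y hy, hym]
  rw [C.sqDist_toM hx₁, C.sqDist_toM hy₁, ← hxm, C.sqDist_toM hx]
  -- If the two preimages of `m` coincide, everything happens in one planar face and equality holds.
  -- Otherwise they lie on different sides representing one edge.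
  by_cases hsame : f = g ∧ x = y
  · obtain ⟨rfl, rfl⟩ := hsame
    have hxx0 : dist x x < ε f x := by rw [dist_self]; exact hε f x
    have hxiso := hiso f x hx hxc
    exact (C.apexSq_add_apexSq f
      (by rw [← hxiso _ hx₁ hxx _ hx hxx0, hxm, h1]) (by rw [← hxiso _ hy₁ hyy _ hx hxx0, hxm, h2])
      (by rw [← hxiso _ hx₁ hxx _ hy₁ hyy, h3])).le
  have hxy : C.T.toM f x = C.T.toM g y := hxm.trans hym.symm
  have hxi : x ∉ interior (solidTriangle (C.T.corner f)) := by
    intro hi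
    obtain ⟨rfl, rfl⟩ := C.T.interior_unique f g x hi y hy hxy
    exact hsame ⟨rfl, rfl⟩
  have hyi : y ∉ interior (solidTriangle (C.T.corner g)) := by
    intro hi
    obtain ⟨rfl, rfl⟩ := C.T.interior_unique g f y hi x hx hxy.symm
    exact hsame ⟨rfl, rfl⟩
  obtain ⟨k, hk⟩ := mem_triOpenSide_of_notMem_interior (C.T.nondegenerate f) hx hxc hxi
  obtain ⟨l, hl⟩ := mem_triOpenSide_of_notMem_interior (C.T.nondegenerate g) hy hyc hyi
  have hne : (f, k) ≠ (g, l) := by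
    intro h
    obtain ⟨rfl, rfl⟩ := Prod.mk.inj h
    exact hsame ⟨rfl, C.T.side_injOn f k hk hl hxy⟩
  exact hC.apexSq_add_le_of_edge hne hk hxc hl hxm hym hε hiso hε₀ hc0 hc himg hx₁ hy₁ hxx hyy
    (hρ.trans_le (min_le_left _ _)) h1 h2 h3

/-- A convex couple has the largest squared distance function among the couples with the same
radii. -/
theorem IsConvex.sqDist_le {C C' : Couple M} (hM : IsEuclideanPolyhedral M) (hC : C.IsConvex)
    (hr : C.r = C'.r) (m : M) : C'.sqDist m ≤ C.sqDist m := by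
  obtain ⟨g, x, hx, rfl⟩ := C'.T.covers m
  -- Working on a face of `C'` makes the second difference of the subtracted function exactly `2ρ²`,
  -- while that of `C.sqDist` is at most `2ρ²`.
  have key := nonneg_of_midpoint_le (C'.T.isCompact_tri g)
    (u := fun x => C.sqDist (C'.T.toM g x) - C'.apexSq g x) (S := range (C'.T.corner g))
    ((C.continuous_sqDist.comp_continuousOn (C'.T.continuousOn g)).sub
      (C'.continuous_apexSq g).continuousOn) ?_ ?_ x hx
  · rw [C'.sqDist_toM hx]
    linarith
  · intro x hx hxc
    have hs := (C'.T.vertex_iff g x hx).2 hxc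
    rw [C.sqDist_of_singular hs, C'.apexSq_eq_of_singular hx hs, hr, sub_self]
  · intro x hx hxc
    have hs : C'.T.toM g x ∉ singularSet M := by rwa [C'.T.vertex_iff g x hx]
    obtain ⟨ε₁, hε₁, hle⟩ := hC.exists_sqDist_add_le ((hM _).resolve_right hs) hs
    obtain ⟨ε₂, hε₂, hiso⟩ := C'.T.local_isometry g x hx hxc
    obtain ⟨v, hv, hp, hm⟩ := exists_add_sub_mem_solidTriangle hx hxc
    rw [sub_eq_add_neg] at hm
    have hK := C'.T.convex_tri g
    have hIoo : ∀ᶠ s in 𝓝[>] (0 : ℝ), s ∈ Ioo 0 1 := Ioo_mem_nhdsGT zero_lt_one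
    obtain ⟨s, hs, h1, h2, h3⟩ := (hIoo.and
      (((tendsto_add_smul_nhdsGT x v).eventually (ball_mem_nhds _ hε₂)).and
      (((tendsto_add_smul_nhdsGT x (-v)).eventually (ball_mem_nhds _ hε₂)).and
      ((tendsto_add_smul_nhdsGT x v).eventually (ball_mem_nhds _ hε₁))))).exists
    have hp' := hK.add_smul_mem_of_add_mem hx hp hs.1.le hs.2.le
    have hm' := hK.add_smul_mem_of_add_mem hx hm hs.1.le hs.2.le
    have d1 : dist (x + s • v) x = s * ‖v‖ := by
      rw [dist_eq_norm, add_sub_cancel_left, norm_smul, Real.norm_of_nonneg hs.1.le]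
    have d2 : dist (x + s • -v) x = s * ‖v‖ := by
      rw [dist_eq_norm, add_sub_cancel_left, norm_smul, Real.norm_of_nonneg hs.1.le, norm_neg]
    have d3 : dist (x + s • v) (x + s • -v) = 2 * (s * ‖v‖) := by
      rw [dist_eq_norm, show x + s • v - (x + s • -v) = (2 * s) • v by module, norm_smul,
        Real.norm_of_nonneg (by linarith [hs.1]), mul_assoc]
    have hx0 := mem_ball_self (x := x) hε₂
    have q1 := C'.apexSq_add_apexSq g d1 d2 d3
    have q2 := hle (s * ‖v‖) (d1 ▸ h3) (C'.T.toM g (x + s • v)) (C'.T.toM g (x + s • -v))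
      (by rw [hiso _ ⟨hp', h1⟩ _ ⟨hx, hx0⟩, d1]) (by rw [hiso _ ⟨hm', h2⟩ _ ⟨hx, hx0⟩, d2])
      (by rw [hiso _ ⟨hp', h1⟩ _ ⟨hm', h2⟩, d3])
    refine ⟨s • v, smul_ne_zero hs.1.ne' hv, hp', ?_, ?_⟩
    · simpa [sub_eq_add_neg] using hm'
    · rw [sub_eq_add_neg x, ← smul_neg]
      linarith

theorem IsConvex.sqDist_eq {C C' : Couple M} (hM : IsEuclideanPolyhedral M) (hC : C.IsConvex)
    (hC' : C'.IsConvex) (hr : C.r = C'.r) : C.sqDist = C'.sqDist :=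
  funext fun m => le_antisymm (hC'.sqDist_le hM hr.symm m) (hC.sqDist_le hM hr m)

end Couple

/-! ### Cone coordinates on the glued complex -/

namespace Couple

variable {M : Type*} [MetricSpace M] (C : Couple M)

/-- The point dividing the segment from the apex to the base point `x` in the ratio given by `t`. -/
noncomputable def facePoint (f : Fin C.T.numFaces) (x : E2) (t : ℝ) : E3 :=
  AffineMap.lineMap (C.apex f) (planeIncl x) t

theorem facePoint_eq (f : Fin C.T.numFaces) (x : E2) (t : ℝ) :
    C.facePoint f x t = C.apex f + t • (planeIncl x - C.apex f) := by
  rw [facePoint, AffineMap.lineMap_apply_module']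
  abel

theorem facePoint_zero (f : Fin C.T.numFaces) (x : E2) : C.facePoint f x 0 = C.apex f := by
  simp [facePoint]

theorem facePoint_one (f : Fin C.T.numFaces) (x : E2) : C.facePoint f x 1 = planeIncl x := by
  simp [facePoint]

theorem facePoint_mem {f : Fin C.T.numFaces} {x : E2} (hx : x ∈ C.T.tri f) (t : unitInterval) :
    C.facePoint f x t ∈ C.pyramid f :=
  (convex_convexHull ℝ _).lineMap_mem (C.apex_mem f) (C.planeIncl_mem hx) t.2

theorem facePoint_apply_two (f : Fin C.T.numFaces) (x : E2) (t : ℝ) :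
    C.facePoint f x t 2 = (1 - t) * C.apex f 2 := by
  simp [facePoint_eq, planeIncl_apply_two]
  ring

/-- The height above the base recovers the ratio, because the apex has positive height. -/
theorem facePoint_injective {f : Fin C.T.numFaces} {x x' : E2} {t t' : ℝ}
    (h : C.facePoint f x t = C.facePoint f x' t') : t = t' ∧ (t = 0 ∨ x = x') := by
  have h2 := congrArg (fun y : E3 => y 2) h
  simp only [facePoint_apply_two] at h2
  have ht : t = t' := by
    have := mul_right_cancel₀ (C.apex_height_pos f).ne' h2
    linarith
  refine ⟨ht, or_iff_not_imp_left.2 fun ht0 => ?_⟩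
  rw [facePoint_eq, facePoint_eq, ← ht, add_right_inj] at h
  exact planeIncl_injective (sub_left_injective (smul_right_injective _ ht0 h))

theorem exists_facePoint {f : Fin C.T.numFaces} {y : E3} (hy : y ∈ C.pyramid f) :
    ∃ x ∈ C.T.tri f, ∃ t : unitInterval, C.facePoint f x t = y := by
  have hne : (range fun k => planeIncl (C.T.corner f k)).Nonempty := range_nonempty _
  rw [pyramid, convexHull_insert hne, mem_convexJoin] at hy
  obtain ⟨a, ha, z, hz, hy⟩ := hy
  rw [mem_singleton_iff] at ha
  subst ha
  have himg : convexHull ℝ (range fun k => planeIncl (C.T.corner f k))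
      = planeInclIsometry.toLinearMap '' C.T.tri f := by
    rw [GeodesicTriangulation.tri, solidTriangle, LinearMap.image_convexHull, ← range_comp]
    rfl
  rw [himg] at hz
  obtain ⟨x, hx, rfl⟩ := hz
  rw [segment_eq_image_lineMap] at hy
  obtain ⟨t, ht, rfl⟩ := hy
  exact ⟨x, hx, ⟨t, ht⟩, rfl⟩

/-- The law of cosines at the apex. Only ratios, values of `apexSq` and the base distance occur, so
equal functions on `M` give equal local metrics. -/
theorem dist_facePoint_sq (f : Fin C.T.numFaces) (x y : E2) (t s : ℝ) :
    dist (C.facePoint f x t) (C.facePoint f y s) ^ 2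
      = t ^ 2 * C.apexSq f x + s ^ 2 * C.apexSq f y
        - t * s * (C.apexSq f x + C.apexSq f y - dist x y ^ 2) := by
  have h := inner_eq_of_dist (C.apex f) (planeIncl x) (planeIncl y)
  rw [dist_planeIncl, dist_comm (planeIncl x), dist_comm (planeIncl y)] at h
  have hx : ‖planeIncl x - C.apex f‖ ^ 2 = C.apexSq f x := by
    rw [apexSq, dist_comm, dist_eq_norm]
  have hy : ‖planeIncl y - C.apex f‖ ^ 2 = C.apexSq f y := by
    rw [apexSq, dist_comm, dist_eq_norm]
  rw [facePoint_eq, facePoint_eq, dist_eq_norm, add_sub_add_left_eq_sub, norm_sub_sq_real,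
    norm_smul, norm_smul, mul_pow, mul_pow, hx, hy, real_inner_smul_left, real_inner_smul_right, h,
    Real.norm_eq_abs, Real.norm_eq_abs, sq_abs, sq_abs]
  unfold apexSq
  ring

theorem dist_facePoint_eq {C C' : Couple M} (hq : C.sqDist = C'.sqDist) {f : Fin C.T.numFaces}
    {g : Fin C'.T.numFaces} {x y x' y' : E2} (hx : x ∈ C.T.tri f) (hy : y ∈ C.T.tri f)
    (hx' : x' ∈ C'.T.tri g) (hy' : y' ∈ C'.T.tri g) (hxx : C.T.toM f x = C'.T.toM g x')
    (hyy : C.T.toM f y = C'.T.toM g y') (hd : dist x y = dist x' y') (t s : ℝ) :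
    dist (C.facePoint f x t) (C.facePoint f y s)
      = dist (C'.facePoint g x' t) (C'.facePoint g y' s) := by
  refine (sq_eq_sq₀ dist_nonneg dist_nonneg).1 ?_
  rw [dist_facePoint_sq, dist_facePoint_sq, ← C.sqDist_toM hx, ← C.sqDist_toM hy,
    ← C'.sqDist_toM hx', ← C'.sqDist_toM hy', hxx, hyy, hd, hq]

/-- The point of the complex that divides the segment from the apex to the boundary point `m` in the
ratio given by `t`. -/
noncomputable def conePoint (m : M) (t : unitInterval) : C.Polyhedron :=
  C.pointOf (C.T.covers m).choose
    ⟨_, C.facePoint_mem (C.T.covers m).choose_spec.choose_spec.1 t⟩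

theorem pointOf_facePoint {f : Fin C.T.numFaces} {x : E2} (hx : x ∈ C.T.tri f) (t : unitInterval) :
    C.pointOf f ⟨_, C.facePoint_mem hx t⟩ = C.conePoint (C.T.toM f x) t :=
  Quot.sound ⟨t, t.2, x, hx, _, (C.T.covers (C.T.toM f x)).choose_spec.choose_spec.1, rfl, rfl,
    Or.inr (C.T.covers (C.T.toM f x)).choose_spec.choose_spec.2.symm⟩

theorem exists_conePoint (P : C.Polyhedron) : ∃ m t, C.conePoint m t = P := by
  obtain ⟨⟨f, y, hy⟩, rfl⟩ := Quot.exists_rep P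
  obtain ⟨x, hx, t, rfl⟩ := C.exists_facePoint hy
  exact ⟨_, t, (C.pointOf_facePoint hx t).symm⟩

theorem conePoint_zero (m m' : M) : C.conePoint m 0 = C.conePoint m' 0 :=
  Quot.sound ⟨0, by simp, _, (C.T.covers m).choose_spec.choose_spec.1, _,
    (C.T.covers m').choose_spec.choose_spec.1, rfl, rfl, Or.inl rfl⟩

/-- The ratio and the boundary point that a point of a pyramid determines. -/
noncomputable def pieceCoord (y : C.Pieces) : ℝ × Set M :=
  (1 - (y.2 : E3) 2 / C.apex y.1 2,
    {m | (y.2 : E3) ≠ C.apex y.1 ∧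
      ∃ x ∈ C.T.tri y.1, C.T.toM y.1 x = m ∧ ∃ t, (y.2 : E3) = C.facePoint y.1 x t})

open Classical in
theorem pieceCoord_eq {y : C.Pieces} {x : E2} (hx : x ∈ C.T.tri y.1) {t : ℝ}
    (hy : (y.2 : E3) = C.facePoint y.1 x t) :
    C.pieceCoord y = (t, if t = 0 then ∅ else {C.T.toM y.1 x}) := by
  refine Prod.ext ?_ ?_
  · have := (C.apex_height_pos y.1).ne'
    simp only [pieceCoord, hy, facePoint_apply_two]
    field_simp
    ring
  · ext m
    simp only [pieceCoord, hy, mem_ofPred_eq]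
    split_ifs with ht
    · simp [ht, facePoint_zero]
    · rw [mem_singleton_iff]
      constructor
      · rintro ⟨-, x', hx', rfl, s, hs⟩
        rw [((C.facePoint_injective hs).2.resolve_left ht)]
      · rintro rfl
        refine ⟨fun h => ht ?_, x, hx, rfl, t, rfl⟩
        rw [← C.facePoint_zero y.1 x] at h
        exact (C.facePoint_injective h).1

theorem pieceCoord_eq_of_glued {y z : C.Pieces} (h : C.Glued y z) :
    C.pieceCoord y = C.pieceCoord z := by
  obtain ⟨t, -, x, hx, x', hx', hy, hz, h⟩ := h
  rw [C.pieceCoord_eq hx hy, C.pieceCoord_eq hx' hz]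
  rcases h with rfl | h
  · simp
  · rw [h]

/-- `Quot` glues along the equivalence relation generated by `Glued`. Lifting the invariant
`pieceCoord` shows that this identifies nothing beyond the apices and the points with equal cone
coordinates. -/
theorem eq_of_conePoint_eq {m m' : M} {t t' : unitInterval}
    (h : C.conePoint m t = C.conePoint m' t') : t = t' ∧ (t = 0 ∨ m = m') := by
  classical
  have key : ∀ (m : M) (t : unitInterval),
      Quot.lift C.pieceCoord (fun _ _ => C.pieceCoord_eq_of_glued) (C.conePoint m t)
        = ((t : ℝ), if (t : ℝ) = 0 then ∅ else {m}) := by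
    intro m t
    have hm := (C.T.covers m).choose_spec.choose_spec
    refine (C.pieceCoord_eq hm.1 rfl).trans ?_
    rw [hm.2]
  have h' := congrArg (Quot.lift C.pieceCoord fun _ _ => C.pieceCoord_eq_of_glued) h
  rw [key, key] at h'
  obtain ⟨h1, h2⟩ := Prod.mk.inj h'
  have ht : t = t' := Subtype.ext h1
  subst ht
  refine ⟨rfl, or_iff_not_imp_left.2 fun ht => ?_⟩
  have ht' : (t : ℝ) ≠ 0 := fun h => ht (Subtype.ext h)
  simpa [ht'] using h2

theorem boundaryPoint_eq_conePoint {f : Fin C.T.numFaces} {x : E2} (hx : x ∈ C.T.tri f) :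
    C.boundaryPoint f x hx = C.conePoint (C.T.toM f x) 1 := by
  rw [← C.pointOf_facePoint hx, boundaryPoint]
  congr 2
  exact (C.facePoint_one f x).symm

theorem apexPoint_eq_conePoint (f : Fin C.T.numFaces) (m : M) :
    C.apexPoint f = C.conePoint m 0 := by
  have hx := C.T.corner_mem_tri f 0
  rw [C.conePoint_zero m (C.T.toM f (C.T.corner f 0)), ← C.pointOf_facePoint hx, apexPoint]
  congr 2
  exact (C.facePoint_zero f _).symm

/-! ### The intrinsic distance -/

variable {C}

theorem Chain.nonneg {P Q : C.Polyhedron} {ℓ : ℝ} (h : C.Chain P Q ℓ) : 0 ≤ ℓ := by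
  induction h with
  | nil => exact le_rfl
  | cons f y z Q ℓ h ih => exact add_nonneg dist_nonneg ih

theorem Chain.trans {P Q R : C.Polyhedron} {ℓ ℓ' : ℝ} (h : C.Chain P Q ℓ) (h' : C.Chain Q R ℓ') :
    C.Chain P R (ℓ + ℓ') := by
  induction h with
  | nil => rwa [zero_add]
  | cons f y z Q ℓ h ih => rw [add_assoc]; exact Chain.cons f y z R _ (ih h')

variable (C)

theorem chain_pointOf (f : Fin C.T.numFaces) (y z : C.pyramid f) :
    C.Chain (C.pointOf f y) (C.pointOf f z) (dist y z) := by
  simpa using Chain.cons f y z _ 0 (Chain.nil (C.pointOf f z))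

theorem exists_chain (P Q : C.Polyhedron) : ∃ ℓ, C.Chain P Q ℓ := by
  obtain ⟨⟨f, y⟩, rfl⟩ := Quot.exists_rep P
  obtain ⟨⟨g, z⟩, rfl⟩ := Quot.exists_rep Q
  have h1 := C.chain_pointOf f y ⟨_, C.apex_mem f⟩
  have h2 := C.chain_pointOf g ⟨_, C.apex_mem g⟩ z
  have h : C.pointOf f ⟨_, C.apex_mem f⟩ = C.pointOf g ⟨_, C.apex_mem g⟩ := C.apexPoint_eq f g
  rw [h] at h1
  exact ⟨_, h1.trans h2⟩

variable {C}

theorem Chain.polyDist_le {P Q : C.Polyhedron} {ℓ : ℝ} (h : C.Chain P Q ℓ) :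
    C.polyDist P Q ≤ ℓ :=
  csInf_le ⟨0, fun _ h => h.nonneg⟩ h

theorem le_polyDist {P Q : C.Polyhedron} {b : ℝ} (h : ∀ ℓ, C.Chain P Q ℓ → b ≤ ℓ) :
    b ≤ C.polyDist P Q :=
  le_csInf (C.exists_chain P Q) h

variable (C)

theorem polyDist_self_le (P : C.Polyhedron) : C.polyDist P P ≤ 0 := (Chain.nil P).polyDist_le

theorem polyDist_triangle (P Q R : C.Polyhedron) :
    C.polyDist P R ≤ C.polyDist P Q + C.polyDist Q R := by
  rw [← sub_le_iff_le_add]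
  refine le_polyDist fun ℓ' h' => ?_
  rw [sub_le_comm]
  refine le_polyDist fun ℓ h => ?_
  linarith [(h'.trans h).polyDist_le]

theorem polyDist_conePoint_le {f : Fin C.T.numFaces} {x y : E2} (hx : x ∈ C.T.tri f)
    (hy : y ∈ C.T.tri f) (t s : unitInterval) :
    C.polyDist (C.conePoint (C.T.toM f x) t) (C.conePoint (C.T.toM f y) s)
      ≤ dist (C.facePoint f x t) (C.facePoint f y s) := by
  rw [← C.pointOf_facePoint hx, ← C.pointOf_facePoint hy]
  exact (C.chain_pointOf f _ _).polyDist_le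

theorem dist_apex_eq_of_glued {y z : C.Pieces} (h : C.Glued y z) :
    dist (y.2 : E3) (C.apex y.1) = dist (z.2 : E3) (C.apex z.1) := by
  obtain ⟨t, -, x, hx, x', hx', hy, hz, h⟩ := h
  rw [hy, hz, dist_lineMap_left, dist_lineMap_left]
  rcases h with rfl | h
  · simp
  · have := C.apexSq_eq_of_toM_eq hx hx' h
    rw [(sq_eq_sq₀ dist_nonneg dist_nonneg).1 this]

/-- The distance to the apex along the straight segment. -/
noncomputable def apexDist : C.Polyhedron → ℝ :=
  Quot.lift (fun y : C.Pieces => dist (y.2 : E3) (C.apex y.1)) fun _ _ => C.dist_apex_eq_of_glued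

theorem apexDist_le_add {P Q : C.Polyhedron} {ℓ : ℝ} (h : C.Chain P Q ℓ) :
    C.apexDist Q ≤ C.apexDist P + ℓ := by
  induction h with
  | nil => simp
  | cons f y z Q ℓ h ih =>
    have h1 : C.apexDist (C.pointOf f z) ≤ dist y z + C.apexDist (C.pointOf f y) :=
      dist_triangle_left (z : E3) (C.apex f) (y : E3)
    linarith

/-- The straight segment is itself a chain. No chain is shorter, since `apexDist` grows along a
chain by at most its length. -/
theorem polyDist_apexPoint_boundaryPoint {f : Fin C.T.numFaces} {x : E2} (hx : x ∈ C.T.tri f) :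
    C.polyDist (C.apexPoint f) (C.boundaryPoint f x hx) = dist (C.apex f) (planeIncl x) := by
  refine le_antisymm (C.chain_pointOf f _ _).polyDist_le (le_polyDist fun ℓ h => ?_)
  have h' := C.apexDist_le_add h
  have h0 : C.apexDist (C.apexPoint f) = 0 := dist_self (C.apex f)
  have h1 : C.apexDist (C.boundaryPoint f x hx) = dist (planeIncl x) (C.apex f) := rfl
  rw [h0, h1, zero_add, dist_comm] at h'
  exact h'

/-- Equivalent couples have the same radii. -/
theorem Equivalent.r_eq {C C' : Couple M} (h : Equivalent C C') : C.r = C'.r := by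
  obtain ⟨Φ, h1, h2, h3⟩ := h
  funext ⟨m, hm⟩
  obtain ⟨f, x, hx, rfl⟩ := C.T.covers m
  obtain ⟨g, y, hy, hxy⟩ := C'.T.covers (C.T.toM f x)
  change x ∈ C.T.tri f at hx
  change y ∈ C'.T.tri g at hy
  have hm' : C'.T.toM g y ∈ singularSet M := hxy ▸ hm
  have hd := h1 (C.apexPoint f) (C.boundaryPoint f x hx)
  rw [h3 f g, h2 f x hx g y hy hxy.symm, polyDist_apexPoint_boundaryPoint,
    polyDist_apexPoint_boundaryPoint] at hd
  have e1 := C.apexSq_eq_of_singular hx hm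
  have e2 := C'.apexSq_eq_of_singular hy hm'
  rw [apexSq, (sq_eq_sq₀ dist_nonneg (C.r_pos _).le)] at e1
  rw [apexSq, (sq_eq_sq₀ dist_nonneg (C'.r_pos _).le)] at e2
  rw [← e1, ← hd, e2]
  simp only [hxy]

end Couple

/-! ### Equal squared distances give equal intrinsic metrics -/

theorem notMem_range_of_mem_openSegment {p : Fin 3 → E2} (hp : AffineIndependent ℝ p) {x y z : E2}
    (hy : y ∈ solidTriangle p) (hz : z ∈ solidTriangle p) (hyz : y ≠ z)
    (hx : x ∈ openSegment ℝ y z) : x ∉ range p := by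
  have htop : affineSpan ℝ (range p) = ⊤ := by
    apply hp.affineSpan_eq_top_iff_card_eq_finrank_add_one.2
    simp
  let b : AffineBasis (Fin 3) ℝ E2 := ⟨p, hp, htop⟩
  have hnn : ∀ w ∈ solidTriangle p, ∀ i, 0 ≤ b.coord i w := by
    intro w hw
    have : w ∈ convexHull ℝ (range b) := hw
    rwa [AffineBasis.convexHull_eq_nonneg_coord] at this
  have hle : ∀ w ∈ solidTriangle p, ∀ i, b.coord i w ≤ 1 := by
    intro w hw i
    rw [← b.sum_coord_apply_eq_one w]
    exact Finset.single_le_sum (fun j _ => hnn w hw j) (Finset.mem_univ i)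
  have hone : ∀ w ∈ solidTriangle p, ∀ i, b.coord i w = 1 → w = p i := by
    intro w hw i hi
    have hsum := b.sum_coord_apply_eq_one w
    rw [← Finset.add_sum_erase _ _ (Finset.mem_univ i), hi, add_eq_left,
      Finset.sum_eq_zero_iff_of_nonneg fun j _ => hnn w hw j] at hsum
    rw [← b.linear_combination_coord_eq_self w, ← Finset.add_sum_erase _ _ (Finset.mem_univ i), hi,
      Finset.sum_eq_zero fun j hj => by rw [hsum j hj, zero_smul], one_smul, add_zero]
    rfl
  -- At corner `k` the barycentric coordinate `k` attains its maximum `1`, and only there; so both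
  -- ends of the segment would be that corner.
  rintro ⟨k, rfl⟩
  obtain ⟨s, t, hs, ht, hst, hk⟩ := hx
  have hcoord : b.coord k (p k) = s * b.coord k y + t * b.coord k z := by
    rw [← hk, Convex.combo_affine_apply hst, smul_eq_mul, smul_eq_mul]
  rw [show b.coord k (p k) = 1 from b.coord_apply_eq k] at hcoord
  have h1 := hle y hy k
  have h2 := hle z hz k
  have hy1 : b.coord k y = 1 := by nlinarith
  have hz1 : b.coord k z = 1 := by nlinarith
  exact hyz ((hone y hy k hy1).trans (hone z hz k hz1).symm)

/-- A distance that is locally Lipschitz along an interval is Lipschitz between its endpoints. -/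
theorem le_mul_sub_of_locally_le {D : ℝ → ℝ → ℝ} (htri : ∀ a b c, D a c ≤ D a b + D b c) {L : ℝ}
    {a b : ℝ} (hab : a ≤ b) (ha : D a a ≤ 0)
    (h : ∀ s ∈ Icc a b, ∀ᶠ u in 𝓝 s, D s u ≤ L * |u - s| ∧ D u s ≤ L * |u - s|) :
    D a b ≤ L * (b - a) := by
  -- Continuous induction: `S` is closed in the interval and extends to the right. As `D` need not
  -- be symmetric, the two local bounds serve these two properties separately.
  set S : Set ℝ := {s | D a s ≤ L * (s - a)} with hS
  have hclosed : IsClosed (S ∩ Icc a b) := by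
    refine isClosed_of_closure_subset fun s hs => ?_
    have hsI : s ∈ Icc a b := isClosed_Icc.closure_subset_iff.2 inter_subset_right hs
    refine ⟨?_, hsI⟩
    rw [hS, mem_ofPred_eq]
    refine le_of_forall_pos_le_add fun ε hε => ?_
    have hev : ∀ᶠ u in 𝓝 s, L * (u - a) + L * |u - s| < L * (s - a) + ε := by
      have hc : Continuous fun u => L * (u - a) + L * |u - s| := by fun_prop
      refine (hc.tendsto s).eventually_lt_const ?_
      simpa using hε
    obtain ⟨u, ⟨hu, -⟩, hu1, hu2⟩ :=
      ((mem_closure_iff_frequently.1 hs).and_eventually ((h s hsI).and hev)).exists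
    rw [hS, mem_ofPred_eq] at hu
    linarith [htri a u s, hu1.2]
  refine hclosed.mem_of_ge_of_forall_exists_gt (s := S) (by simpa [hS] using ha) hab ?_
  rintro s ⟨hs, hsI⟩
  have h1 : ∀ᶠ u in 𝓝[>] s, u ∈ Ioc s b := Ioc_mem_nhdsGT hsI.2
  obtain ⟨u, hu, hu1, -⟩ :=
    (h1.and ((h s ⟨hsI.1, hsI.2.le⟩).filter_mono nhdsWithin_le_nhds)).exists
  refine ⟨u, ?_, hu⟩
  rw [hS, mem_ofPred_eq] at hs ⊢
  rw [abs_of_pos (sub_pos.2 hu.1)] at hu1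
  linarith [htri a s u]

namespace Couple

variable {M : Type*} [MetricSpace M] (C : Couple M)

theorem dist_facePoint_le (f : Fin C.T.numFaces) (x y : E2) (t s : unitInterval) :
    dist (C.facePoint f x t) (C.facePoint f y s)
      ≤ dist x y + dist t s * √(C.apexSq f y) := by
  refine (dist_triangle _ (C.facePoint f y t) _).trans (add_le_add ?_ ?_)
  · rw [facePoint_eq, facePoint_eq, dist_add_left, dist_smul₀, dist_sub_right, dist_planeIncl,
      Real.norm_of_nonneg t.2.1]
    exact mul_le_of_le_one_left dist_nonneg t.2.2
  · rw [facePoint, facePoint, dist_lineMap_lineMap, apexSq, Real.sqrt_sq dist_nonneg]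
    rfl

/-- Continuity that holds at vertices too: it compares points inside one face and needs no local
isometry. -/
theorem eventually_polyDist_conePoint_lt (m : M) (t : unitInterval) {ε : ℝ} (hε : 0 < ε) :
    ∀ᶠ p : M × unitInterval in 𝓝 (m, t),
      C.polyDist (C.conePoint m t) (C.conePoint p.1 p.2) < ε ∧
      C.polyDist (C.conePoint p.1 p.2) (C.conePoint m t) < ε := by
  have h1 : ∀ᶠ m' in 𝓝 m, ∀ f, ∀ x ∈ C.T.tri f, C.T.toM f x = m' →
      ∃ x₀ ∈ C.T.tri f, C.T.toM f x₀ = m ∧ dist x x₀ < ε / 2 :=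
    C.T.eventually_preimage_near (ε := fun _ _ => ε / 2) (fun _ _ => half_pos hε) m
  have h2 : ∀ᶠ s in 𝓝 t, dist s t * √(C.sqDist m) < ε / 2 := by
    have hc : Continuous fun s => dist s t * √(C.sqDist m) := by fun_prop
    refine (hc.tendsto t).eventually_lt_const ?_
    simpa using hε
  filter_upwards [h1.prod_nhds h2] with ⟨m', s⟩ ⟨hm', hs⟩
  obtain ⟨f, x, hx, rfl⟩ := C.T.covers m'
  obtain ⟨x₀, hx₀, rfl, hd⟩ := hm' f x hx rfl
  have hle := C.dist_facePoint_le f x x₀ s t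
  rw [C.sqDist_toM hx₀] at hs
  exact ⟨(C.polyDist_conePoint_le hx₀ hx t s).trans_lt (by rw [dist_comm]; linarith),
    (C.polyDist_conePoint_le hx hx₀ s t).trans_lt (by linarith)⟩

variable {C} {C' : Couple M}

/-- A complex with the same squared distance function measures straight segments in the same way, as
long as their projections to the boundary avoid the vertices. -/
theorem eventually_polyDist_le (hq : C.sqDist = C'.sqDist) {f : Fin C.T.numFaces} {x : ℝ → E2}
    {t : ℝ → unitInterval} {s : ℝ} (hx : ∀ᶠ u in 𝓝 s, x u ∈ C.T.tri f)
    (hxs : x s ∉ range (C.T.corner f)) (hxc : ContinuousAt x s) :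
    ∀ᶠ u in 𝓝 s,
      C'.polyDist (C'.conePoint (C.T.toM f (x s)) (t s)) (C'.conePoint (C.T.toM f (x u)) (t u))
        ≤ dist (C.facePoint f (x u) (t u)) (C.facePoint f (x s) (t s)) ∧
      C'.polyDist (C'.conePoint (C.T.toM f (x u)) (t u)) (C'.conePoint (C.T.toM f (x s)) (t s))
        ≤ dist (C.facePoint f (x u) (t u)) (C.facePoint f (x s) (t s)) := by
  obtain ⟨ε, hε, hiso⟩ := C.T.exists_isoRadius
  obtain ⟨ε', hε', hiso'⟩ := C'.T.exists_isoRadius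
  have hs := hx.self_of_nhds
  have htoM : Tendsto (fun u => C.T.toM f (x u)) (𝓝 s) (𝓝 (C.T.toM f (x s))) :=
    (C.T.continuousOn f _ hs).tendsto.comp (tendsto_nhdsWithin_iff.2 ⟨hxc, hx⟩)
  filter_upwards [hx, hxc.eventually (ball_mem_nhds _ (hε f (x s))),
    htoM.eventually (C'.T.eventually_preimage_near hε' _)] with u hu hux hnear
  -- The nearby point and a preimage of the centre lie in one face `g` of `C'`, so a single segment
  -- of the pyramid over `g` joins them.
  obtain ⟨g, y, hy, hym⟩ := C'.T.covers (C.T.toM f (x u))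
  obtain ⟨y₀, hy₀, hym₀, hd⟩ := hnear g y hy hym
  have hy₀c : y₀ ∉ range (C'.T.corner g) := by
    rwa [← C'.T.vertex_iff g y₀ hy₀, hym₀, C.T.vertex_iff f _ hs]
  have hdist : dist (x u) (x s) = dist y y₀ := by
    rw [← hiso f _ hs hxs _ hu hux _ hs (by rw [dist_self]; exact hε _ _),
      ← hiso' g _ hy₀ hy₀c _ hy hd _ hy₀ (by rw [dist_self]; exact hε' _ _), hym, hym₀]
  rw [dist_facePoint_eq hq hu hs hy hy₀ hym.symm hym₀.symm hdist, ← hym, ← hym₀]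
  exact ⟨(C'.polyDist_conePoint_le hy₀ hy _ _).trans_eq (dist_comm _ _),
    C'.polyDist_conePoint_le hy hy₀ _ _⟩

theorem polyDist_conePoint_le_of_same_base (hq : C.sqDist = C'.sqDist) {f : Fin C.T.numFaces}
    {x : E2} (hx : x ∈ C.T.tri f) (t s : unitInterval) :
    C'.polyDist (C'.conePoint (C.T.toM f x) t) (C'.conePoint (C.T.toM f x) s)
      ≤ dist (C.facePoint f x t) (C.facePoint f x s) := by
  obtain ⟨g, y, hy, hym⟩ := C'.T.covers (C.T.toM f x)
  rw [dist_facePoint_eq hq hx hx hy hy hym.symm hym.symm (by simp), ← hym]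
  exact C'.polyDist_conePoint_le hy hy t s

/-- Transport the straight segment by its cone coordinates. Inside, its base projection avoids the
vertices, so the transported path is locally Lipschitz with the length of the segment as constant.
Vertical segments and those ending at the apex already fit in one pyramid. -/
theorem polyDist_conePoint_le_dist (hq : C.sqDist = C'.sqDist) {f : Fin C.T.numFaces}
    {x₀ x₁ : E2} (hx₀ : x₀ ∈ C.T.tri f) (hx₁ : x₁ ∈ C.T.tri f) (t₀ t₁ : unitInterval) :
    C'.polyDist (C'.conePoint (C.T.toM f x₀) t₀) (C'.conePoint (C.T.toM f x₁) t₁)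
      ≤ dist (C.facePoint f x₀ t₀) (C.facePoint f x₁ t₁) := by
  rcases eq_or_ne x₀ x₁ with rfl | hne
  · exact polyDist_conePoint_le_of_same_base hq hx₀ t₀ t₁
  rcases eq_or_ne t₀ 0 with rfl | ht₀
  · rw [C'.conePoint_zero _ (C.T.toM f x₁), Icc.coe_zero, facePoint_zero, ← C.facePoint_zero f x₁]
    exact polyDist_conePoint_le_of_same_base hq hx₁ 0 t₁
  rcases eq_or_ne t₁ 0 with rfl | ht₁
  · rw [C'.conePoint_zero _ (C.T.toM f x₀), Icc.coe_zero, facePoint_zero, ← C.facePoint_zero f x₀]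
    exact polyDist_conePoint_le_of_same_base hq hx₀ t₀ 0
  have hp₀ : 0 < (t₀ : ℝ) := unitInterval.pos_iff_ne_zero.2 ht₀
  have hp₁ : 0 < (t₁ : ℝ) := unitInterval.pos_iff_ne_zero.2 ht₁
  -- the ratio and the base point along the straight segment
  set τ : ℝ → ℝ := fun s => (1 - s) * t₀ + s * t₁ with hτ
  set t : ℝ → unitInterval := fun s => projIcc 0 1 zero_le_one (τ s) with ht
  set x : ℝ → E2 := fun s => AffineMap.lineMap x₀ x₁ (s * t₁ / τ s) with hx
  have hτpos : ∀ s ∈ Icc (0 : ℝ) 1, 0 < τ s := by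
    intro s hs
    rcases hs.1.eq_or_lt with rfl | h0
    · simpa [hτ] using hp₀
    · have := mul_pos h0 hp₁
      have := mul_nonneg (sub_nonneg.2 hs.2) hp₀.le
      simp only [hτ]; linarith
  have htτ : ∀ s ∈ Icc (0 : ℝ) 1, (t s : ℝ) = τ s := by
    intro s hs
    have h1 : τ s ≤ 1 := by
      have := mul_le_of_le_one_right (sub_nonneg.2 hs.2) t₀.2.2
      have := mul_le_of_le_one_right hs.1 t₁.2.2
      simp only [hτ]; linarith
    simp only [ht]
    rw [projIcc_of_mem zero_le_one ⟨(hτpos s hs).le, h1⟩]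
  have hratio : ∀ s ∈ Icc (0 : ℝ) 1, s * t₁ / τ s ∈ Icc (0 : ℝ) 1 := by
    intro s hs
    have := mul_nonneg (sub_nonneg.2 hs.2) hp₀.le
    refine ⟨div_nonneg (mul_nonneg hs.1 hp₁.le) (hτpos s hs).le, (div_le_one (hτpos s hs)).2 ?_⟩
    simp only [hτ]; linarith
  have hxmem : ∀ s ∈ Icc (0 : ℝ) 1, x s ∈ C.T.tri f := fun s hs =>
    (C.T.convex_tri f).lineMap_mem hx₀ hx₁ (hratio s hs)
  have hxcorner : ∀ s ∈ Ioo (0 : ℝ) 1, x s ∉ range (C.T.corner f) := by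
    intro s hs
    refine notMem_range_of_mem_openSegment (C.T.nondegenerate f) hx₀ hx₁ hne ?_
    rw [openSegment_eq_image_lineMap]
    have hsI := Ioo_subset_Icc_self hs
    refine mem_image_of_mem _ ⟨div_pos (mul_pos hs.1 hp₁) (hτpos s hsI),
      (div_lt_one (hτpos s hsI)).2 ?_⟩
    have := mul_pos (sub_pos.2 hs.2) hp₀
    simp only [hτ]; linarith
  have hτc : Continuous τ := by simp only [hτ]; fun_prop
  have htc : Continuous t := continuous_projIcc.comp hτc
  have hxc : ∀ s ∈ Icc (0 : ℝ) 1, ContinuousAt x s := by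
    intro s hs
    have h1 : ContinuousAt (fun s => s * (t₁ : ℝ) / τ s) s :=
      ContinuousAt.div (by fun_prop) hτc.continuousAt (hτpos s hs).ne'
    exact (AffineMap.lineMap_continuous (R := ℝ)).continuousAt.comp h1
  -- Measured from the apex, the point at parameter `s` is the combination with weights `(1 - s) *
  -- t₀` and `s * t₁`. Their sum `τ s` is the ratio, and the normalized weights give the base point.
  have hY : ∀ s ∈ Icc (0 : ℝ) 1, C.facePoint f (x s) (t s)
      = AffineMap.lineMap (C.facePoint f x₀ t₀) (C.facePoint f x₁ t₁) s := by
    intro s hs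
    have h0 := (hτpos s hs).ne'
    have h1 : planeIncl (x s) = planeIncl x₀
        + (s * t₁ / τ s) • (planeIncl x₁ - planeIncl x₀) := by
      simp only [hx]
      rw [AffineMap.lineMap_apply_module', planeIncl_add, planeIncl_smul, planeIncl_sub, add_comm]
    rw [htτ s hs, facePoint_eq, h1, AffineMap.lineMap_apply_module', facePoint_eq, facePoint_eq,
      add_sub_right_comm, smul_add, smul_smul, mul_div_cancel₀ _ h0]
    simp only [hτ]
    module
  set Γ : ℝ → C'.Polyhedron := fun s => C'.conePoint (C.T.toM f (x s)) (t s) with hΓ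
  set L := dist (C.facePoint f x₀ t₀) (C.facePoint f x₁ t₁) with hL
  have hΓ0 : Γ 0 = C'.conePoint (C.T.toM f x₀) t₀ := by
    simp [hΓ, hx, ht, hτ]
  have hΓ1 : Γ 1 = C'.conePoint (C.T.toM f x₁) t₁ := by
    simp [hΓ, hx, ht, hτ, hp₁.ne']
  have hlocal : ∀ s ∈ Ioo (0 : ℝ) 1, ∀ᶠ u in 𝓝 s,
      C'.polyDist (Γ s) (Γ u) ≤ L * |u - s| ∧ C'.polyDist (Γ u) (Γ s) ≤ L * |u - s| := by
    intro s hs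
    have hsI := Ioo_subset_Icc_self hs
    have hev : ∀ᶠ u in 𝓝 s, u ∈ Ioo (0 : ℝ) 1 := isOpen_Ioo.mem_nhds hs
    filter_upwards [eventually_polyDist_le hq (t := t)
      (hev.mono fun u hu => hxmem u (Ioo_subset_Icc_self hu)) (hxcorner s hs) (hxc s hsI), hev]
      with u hu huI
    rwa [hY s hsI, hY u (Ioo_subset_Icc_self huI), dist_lineMap_lineMap, Real.dist_eq, mul_comm,
      ← hL] at hu
  have hend : ∀ s ∈ Icc (0 : ℝ) 1, ∀ ε > 0, ∀ᶠ u in 𝓝[Icc 0 1] s,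
      C'.polyDist (Γ s) (Γ u) < ε ∧ C'.polyDist (Γ u) (Γ s) < ε := by
    intro s hs ε hε
    have htoM : Tendsto (fun u => C.T.toM f (x u)) (𝓝[Icc 0 1] s) (𝓝 (C.T.toM f (x s))) := by
      refine (C.T.continuousOn f _ (hxmem s hs)).tendsto.comp (tendsto_nhdsWithin_iff.2
        ⟨(hxc s hs).tendsto.mono_left nhdsWithin_le_nhds, ?_⟩)
      filter_upwards [self_mem_nhdsWithin] with u hu using hxmem u hu
    exact (htoM.prodMk_nhds (htc.continuousAt.tendsto.mono_left nhdsWithin_le_nhds)).eventually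
      (C'.eventually_polyDist_conePoint_lt _ _ hε)
  have hL0 : 0 ≤ L := dist_nonneg
  rw [← hΓ0, ← hΓ1]
  -- Short pieces at both ends are cut off at cost `ε`, because `x₀` and `x₁` may be vertices.
  refine le_of_forall_pos_le_add fun ε hε => ?_
  have hlt : (0 : ℝ) < 1 / 2 := by norm_num
  have hlt' : (1 / 2 : ℝ) < 1 := by norm_num
  obtain ⟨a, ha, ha'⟩ : ∃ a ∈ Ioo (0 : ℝ) (1 / 2), C'.polyDist (Γ 0) (Γ a) < ε / 2 := by
    have h := (hend 0 (by simp) (ε / 2) (half_pos hε)).filter_mono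
      (nhdsWithin_mono 0 (Ioo_subset_Icc_self (a := (0 : ℝ)) (b := 1)))
    rw [nhdsWithin_Ioo_eq_nhdsGT one_pos] at h
    have h' : ∀ᶠ u in 𝓝[>] (0 : ℝ), u ∈ Ioo (0 : ℝ) (1 / 2) := Ioo_mem_nhdsGT hlt
    obtain ⟨a, ha, ha'⟩ := (h'.and h).exists
    exact ⟨a, ha, ha'.1⟩
  obtain ⟨b, hb, hb'⟩ : ∃ b ∈ Ioo (1 / 2 : ℝ) 1, C'.polyDist (Γ b) (Γ 1) < ε / 2 := by
    have h := (hend 1 (by simp) (ε / 2) (half_pos hε)).filter_mono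
      (nhdsWithin_mono 1 (Ioo_subset_Icc_self (a := (0 : ℝ)) (b := 1)))
    rw [nhdsWithin_Ioo_eq_nhdsLT one_pos] at h
    have h' : ∀ᶠ u in 𝓝[<] (1 : ℝ), u ∈ Ioo (1 / 2 : ℝ) 1 := Ioo_mem_nhdsLT hlt'
    obtain ⟨b, hb, hb'⟩ := (h'.and h).exists
    exact ⟨b, hb, hb'.2⟩
  have hmid := le_mul_sub_of_locally_le (D := fun u v => C'.polyDist (Γ u) (Γ v))
    (fun _ _ _ => C'.polyDist_triangle _ _ _) (L := L) (ha.2.trans hb.1).le (C'.polyDist_self_le _)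
    (fun s hs => hlocal s ⟨ha.1.trans_le hs.1, hs.2.trans_lt hb.2⟩)
  have hLab : L * (b - a) ≤ L := mul_le_of_le_one_right hL0 (by linarith [ha.1, hb.2])
  have := C'.polyDist_triangle (Γ 0) (Γ a) (Γ 1)
  have := C'.polyDist_triangle (Γ a) (Γ b) (Γ 1)
  linarith

theorem polyDist_conePoint_le_polyDist (hq : C.sqDist = C'.sqDist) (m m' : M)
    (t t' : unitInterval) : C'.polyDist (C'.conePoint m t) (C'.conePoint m' t')
      ≤ C.polyDist (C.conePoint m t) (C.conePoint m' t') := by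
  have key : ∀ P Q ℓ, C.Chain P Q ℓ → ∀ m t m' t', C.conePoint m t = P → C.conePoint m' t' = Q →
      C'.polyDist (C'.conePoint m t) (C'.conePoint m' t') ≤ ℓ := by
    -- Cone coordinates are ambiguous only at the apex, where they are equally ambiguous in `C'`.
    have hcongr : ∀ m t m' t', C.conePoint m t = C.conePoint m' t' →
        C'.conePoint m t = C'.conePoint m' t' := by
      intro m t m' t' h
      obtain ⟨rfl, rfl | rfl⟩ := C.eq_of_conePoint_eq h
      · exact C'.conePoint_zero _ _
      · rfl
    intro P Q ℓ h
    induction h with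
    | nil P =>
      intro m t m' t' h h'
      rw [hcongr m t m' t' (h.trans h'.symm)]
      exact C'.polyDist_self_le _
    | cons f y z Q ℓ h ih =>
      intro m t m' t' hP hQ
      obtain ⟨y, hy⟩ := y
      obtain ⟨z, hz⟩ := z
      obtain ⟨x₀, hx₀, t₀, rfl⟩ := C.exists_facePoint hy
      obtain ⟨x₁, hx₁, t₁, rfl⟩ := C.exists_facePoint hz
      rw [C.pointOf_facePoint hx₀] at hP
      have h1 := ih _ _ m' t' (C.pointOf_facePoint hx₁ t₁).symm hQ
      have h2 := polyDist_conePoint_le_dist hq hx₀ hx₁ t₀ t₁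
      rw [hcongr _ _ _ _ hP]
      exact (C'.polyDist_triangle _ _ _).trans (add_le_add h2 h1)
  exact le_polyDist fun ℓ h => key _ _ ℓ h m t m' t' rfl rfl

theorem polyDist_conePoint_eq (hq : C.sqDist = C'.sqDist) (m m' : M) (t t' : unitInterval) :
    C'.polyDist (C'.conePoint m t) (C'.conePoint m' t')
      = C.polyDist (C.conePoint m t) (C.conePoint m' t') :=
  le_antisymm (polyDist_conePoint_le_polyDist hq m m' t t')
    (polyDist_conePoint_le_polyDist hq.symm m m' t t')

/-- The map between two complexes with boundary `M` that preserves the cone coordinates. -/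
noncomputable def coneMap (C C' : Couple M) (P : C.Polyhedron) : C'.Polyhedron :=
  C'.conePoint (C.exists_conePoint P).choose (C.exists_conePoint P).choose_spec.choose

theorem coneMap_conePoint (C C' : Couple M) (m : M) (t : unitInterval) :
    coneMap C C' (C.conePoint m t) = C'.conePoint m t := by
  have h := (C.exists_conePoint (C.conePoint m t)).choose_spec.choose_spec
  obtain ⟨h1, h2⟩ := C.eq_of_conePoint_eq h
  rw [coneMap, h1]
  rcases h2 with h2 | h2
  · rw [← h1, h2]
    exact C'.conePoint_zero _ _
  · rw [h2]

theorem coneMap_coneMap (C C' : Couple M) (P : C.Polyhedron) :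
    coneMap C' C (coneMap C C' P) = P := by
  obtain ⟨m, t, rfl⟩ := C.exists_conePoint P
  rw [coneMap_conePoint, coneMap_conePoint]

/-- Couples with the same squared distance function on `M` are equivalent. -/
theorem equivalent_of_sqDist_eq (hq : C.sqDist = C'.sqDist) : Equivalent C C' := by
  refine ⟨⟨coneMap C C', coneMap C' C, coneMap_coneMap C C', coneMap_coneMap C' C⟩,
    fun P Q => ?_, fun f x hx g y hy h => ?_, fun f g => ?_⟩
  · obtain ⟨m, t, rfl⟩ := C.exists_conePoint P
    obtain ⟨m', t', rfl⟩ := C.exists_conePoint Q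
    rw [Equiv.coe_fn_mk, coneMap_conePoint, coneMap_conePoint, polyDist_conePoint_eq hq]
  · rw [Equiv.coe_fn_mk, boundaryPoint_eq_conePoint, boundaryPoint_eq_conePoint,
      coneMap_conePoint, h]
  -- Any point of `M` will do, since the cone point with ratio `0` does not depend on it.
  · have m := C.T.toM f 0
    rw [Equiv.coe_fn_mk, C.apexPoint_eq_conePoint f m, C'.apexPoint_eq_conePoint g m,
      coneMap_conePoint]

end Couple

theorem mainTheorem7 {M : Type*} [MetricSpace M] [CompactSpace M] [ConnectedSpace M]
    (hM : IsEuclideanPolyhedral M) (hsing : (singularSet M).Nonempty)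
    (P P' : GeneralizedPolytope M)
    (hP : P ∈ convexPolytopes M) (hP' : P' ∈ convexPolytopes M)
    (C C' : Couple M) (hC : C.polytope = P) (hC' : C'.polytope = P')
    (hr : C.r = C'.r) : P = P' := by
  obtain ⟨D, rfl, hD⟩ := hP
  obtain ⟨D', rfl, hD'⟩ := hP'
  -- Convexity is known for `D` and `D'`, not for the given couples; equality of radii passes to
  -- them because equivalence preserves radii.
  have h1 : Couple.Equivalent C D := Quotient.exact hC
  have h2 : Couple.Equivalent C' D' := Quotient.exact hC'
  exact Quotient.sound (Couple.equivalent_of_sqDist_eq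
    (hD.sqDist_eq hM hD' (h1.r_eq.symm.trans (hr.trans h2.r_eq))))
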